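/- Let $M$ be an $n$-dimensional $C^\infty$-manifold (Hausdorff, second countable), let $S=\{1,\dots,k\}$, and let $u_1,\dots,u_k$ be smooth, forward complete vector fields on $M$ with flows $\Phi_i(t,\eta)$, $t\ge 0$. Let $(X_t,A_t)_{t\ge 0}$ be the $M\times S$-valued switching process: started at $(\xi,i)$, $X$ follows $\Phi_i$ for an exponential time with parameter $\lambda_i>0$; then a new regime is drawn from $S\setminus\{i\}$ with probabilities that depend only on $i$ and are all positive, $X$ follows the flow of the new regime $j$ for an exponential time with parameter $\lambda_j>0$, and so on, where the holding times are independent conditionally on the sequence of regimes, and $A_t$ is the regime at time $t$. (If $k=1$, the only regime is never left.) Let $\mathsf P^t_{\xi,i}$ be the law of $(X_t,A_t)$ started at $(\xi,i)$, and define the resolvent kernel by $$\mathsf Q_{\xi,i}(E\times\{j\})=\int_0^\infty e^{-t}\,\mathsf P^t_{\xi,i}(E\times\{j\})\,dt .$$ Let $\mathcal I$ be the smallest Lie subalgebra of the Lie algebra of smooth vector fields on $M$ that contains $u_1,\dots,u_k$. Suppose that $\xi\in M$ satisfies Condition B, that is, the space $\{v(\xi): v\in\mathcal I\}$ has dimension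 $n$. Then for every $i\in S$ the measure $\mathsf Q_{\xi,i}$ has a nonzero absolutely continuous component with respect to Lebesgue measure on $M\times S$, i.e. the product of counting measure on $S$ with a Borel measure on $M$ that is equivalent to Lebesgue measure in every smooth chart. -/

import Mathlib

open Set MeasureTheory ProbabilityTheory
open scoped Manifold ContDiff

noncomputable section

namespace Switching

/-! ### Vector fields, generated Lie algebra, flows -/

section Geometry

variable {n : ℕ} {M : Type*} [TopologicalSpace M] [ChartedSpace (EuclideanSpace ℝ (Fin n)) M]

/-- A vector field is smooth if it is smooth as a map into the tangent bundle. -/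
def IsSmoothField [IsManifold (𝓡 n) ∞ M] (v : (x : M) → TangentSpace (𝓡 n) x) : Prop :=
  ContMDiff (𝓡 n) (𝓡 n).tangent ∞ (fun x => (⟨x, v x⟩ : TangentBundle (𝓡 n) M))

/-- A subalgebra of the Lie algebra of smooth vector fields: a linear space of smooth vector fields
that is closed under the Lie bracket. -/
def IsLieSubalgebra [IsManifold (𝓡 n) ∞ M]
    (W : Submodule ℝ ((x : M) → TangentSpace (𝓡 n) x)) : Prop :=
  (∀ v ∈ W, IsSmoothField v) ∧
    ∀ v ∈ W, ∀ w ∈ W, VectorField.mlieBracket (𝓡 n) v w ∈ W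

/-- The smallest subalgebra of the Lie algebra of smooth vector fields that contains all `u i`. -/
def generatedLieAlgebra [IsManifold (𝓡 n) ∞ M] {S : Type*}
    (u : S → (x : M) → TangentSpace (𝓡 n) x) :
    Submodule ℝ ((x : M) → TangentSpace (𝓡 n) x) :=
  sInf {W | IsLieSubalgebra W ∧ ∀ i, u i ∈ W}

/-- Condition B at `ξ`: the vectors `v(ξ)`, where `v` runs through the Lie algebra generated by the
`u i`, form a space of dimension `n`. -/
def ConditionB [IsManifold (𝓡 n) ∞ M] {S : Type*}
    (u : S → (x : M) → TangentSpace (𝓡 n) x) (ξ : M) : Prop :=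
  Module.finrank ℝ ((generatedLieAlgebra u).map
    (LinearMap.proj ξ : ((x : M) → TangentSpace (𝓡 n) x) →ₗ[ℝ] TangentSpace (𝓡 n) ξ)) = n

/-- `γ` solves `γ' = v(γ)` on `[0, ∞)` with `γ(0) = η`. -/
def IsForwardSolution (v : (x : M) → TangentSpace (𝓡 n) x) (η : M) (γ : ℝ → M) : Prop :=
  γ 0 = η ∧ IsMIntegralCurveOn γ v (Ici 0)

/-- Forward completeness: solutions exist for all positive times from every starting point. -/
def ForwardComplete (v : (x : M) → TangentSpace (𝓡 n) x) : Prop :=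
  ∀ η : M, ∃ γ : ℝ → M, IsForwardSolution v η γ

open Classical in
/-- The flow `Φ(t, η)`, `t ≥ 0`, of a forward complete vector field (for which the solution of the
initial value problem is unique). It is frozen at `η` for `t < 0`; such times play no role. -/
def flow (v : (x : M) → TangentSpace (𝓡 n) x) (t : ℝ) (η : M) : M :=
  if h : ∃ γ : ℝ → M, IsForwardSolution v η γ then h.choose (max t 0) else η

/-- A Borel measure on `M` is a Lebesgue measure if in every smooth chart it is equivalent to
the Lebesgue measure of Euclidean space, e.g. the volume measure of a Riemannian metric. -/
def IsLebesgueMeasure [MeasurableSpace M] (μ : Measure M) : Prop :=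
  ∀ e ∈ IsManifold.maximalAtlas (𝓡 n) ∞ M,
    (μ.restrict e.source).map e ≪ volume.restrict e.target ∧
      volume.restrict e.target ≪ (μ.restrict e.source).map e

end Geometry

/-! ### Switching times and regimes -/

/-- The parameters of the switching mechanism: the rate `rate i` of the exponential time spent
in the regime `i`, and the law `jump i` of the next regime after `i`, which lives on the regimes
other than `i` and gives positive probability to each of them. If there is only one regime, it
is followed by itself, so that nothing ever changes at a switch. -/
structure SwitchingLaw (S : Type*) where
  rate : S → ℝ
  rate_pos : ∀ i, 0 < rate i
  jump : S → PMF S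
  jump_pos : ∀ i j, i ≠ j → 0 < jump i j
  jump_self : Nontrivial S → ∀ i, jump i i = 0

section Law

variable {S : Type*} [MeasurableSpace S] [DiscreteMeasurableSpace S] [Countable S]

/-- The kernel `i ↦ Exp(rate i)`. -/
def SwitchingLaw.holding (R : SwitchingLaw S) : Kernel S ℝ :=
  Kernel.ofFunOfCountable fun i => expMeasure (R.rate i)

instance (R : SwitchingLaw S) : IsMarkovKernel R.holding :=
  ⟨fun i => isProbabilityMeasure_expMeasure (R.rate_pos i)⟩

/-- The kernel `i ↦ jump i`. -/
def SwitchingLaw.jumpKernel (R : SwitchingLaw S) : Kernel S S :=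
  Kernel.ofFunOfCountable fun i => (R.jump i).toMeasure

instance (R : SwitchingLaw S) : IsMarkovKernel R.jumpKernel :=
  ⟨fun i => PMF.toMeasure.isProbabilityMeasure (R.jump i)⟩

/-- One step of the chain of pairs (regime, time spent in it): from `(i, s)`, a regime `j` is drawn
from `jump i`, and then a time from `Exp(rate j)`. -/
def SwitchingLaw.step (R : SwitchingLaw S) : Kernel (S × ℝ) (S × ℝ) :=
  (R.jumpKernel ⊗ₖ Kernel.prodMkLeft S R.holding).comap Prod.fst measurable_fst

instance (R : SwitchingLaw S) : IsMarkovKernel R.step := by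
  unfold SwitchingLaw.step; infer_instance

/-- The step as a kernel from the past up to `m` to the next pair. -/
def SwitchingLaw.stepKernel (R : SwitchingLaw S) (m : ℕ) :
    Kernel (Finset.Iic m → S × ℝ) (S × ℝ) :=
  R.step.comap (fun x => x ⟨m, Finset.mem_Iic.2 le_rfl⟩) (measurable_pi_apply _)

instance (R : SwitchingLaw S) (m : ℕ) : IsMarkovKernel (R.stepKernel m) := by
  unfold SwitchingLaw.stepKernel; infer_instance

/-- The law of the sequence of successive pairs (regime, time spent in it), started in the
regime `i`. -/
def SwitchingLaw.pathLaw (R : SwitchingLaw S) (i : S) : Measure (ℕ → S × ℝ) :=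
  Kernel.trajMeasure (X := fun _ => S × ℝ) (Measure.dirac i ⊗ₘ R.holding) R.stepKernel

end Law

section Paths

variable {S : Type*}

/-- The time of the `m`-th switch (`0` for `m = 0`). -/
def switchTime (w : ℕ → S × ℝ) (m : ℕ) : ℝ := ∑ l ∈ Finset.range m, (w l).2

/-- The number of switches up to time `t`. -/
def switchCount (w : ℕ → S × ℝ) (t : ℝ) : ℕ := sInf {m | t < switchTime w (m + 1)}

/-- The regime `A_t`. -/
def regimeAt (w : ℕ → S × ℝ) (t : ℝ) : S := (w (switchCount w t)).1

variable {n : ℕ} {M : Type*} [TopologicalSpace M] [ChartedSpace (EuclideanSpace ℝ (Fin n)) M]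

/-- The position at the `m`-th switch, for the starting point `ξ`. -/
def switchPosition (u : S → (x : M) → TangentSpace (𝓡 n) x) (ξ : M) (w : ℕ → S × ℝ) : ℕ → M
  | 0 => ξ
  | m + 1 => flow (u (w m).1) (w m).2 (switchPosition u ξ w m)

/-- The position `X_t`, for the starting point `ξ`. -/
def positionAt (u : S → (x : M) → TangentSpace (𝓡 n) x) (ξ : M) (w : ℕ → S × ℝ) (t : ℝ) : M :=
  flow (u (regimeAt w t)) (t - switchTime w (switchCount w t))
    (switchPosition u ξ w (switchCount w t))

variable [MeasurableSpace M] [MeasurableSpace S] [DiscreteMeasurableSpace S] [Countable S]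

/-- The transition probability `P^t_{ξ,i}`: the law of `(X_t, A_t)` started at `(ξ, i)`. -/
def transition (u : S → (x : M) → TangentSpace (𝓡 n) x) (R : SwitchingLaw S) (ξ : M) (i : S)
    (t : ℝ) : Measure (M × S) :=
  (R.pathLaw i).map fun w => (positionAt u ξ w t, regimeAt w t)

/-- The resolvent `Q_{ξ,i} = ∫ e^{-t} P^t_{ξ,i} dt`, integral over `(0, ∞)`. -/
def resolvent (u : S → (x : M) → TangentSpace (𝓡 n) x) (R : SwitchingLaw S) (ξ : M) (i : S) :
    Measure (M × S) :=
  ((volume.restrict (Ioi (0 : ℝ))).withDensity fun t => ENNReal.ofReal (Real.exp (-t))).bind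
    (transition u R ξ i)

end Paths

/-- The absolutely continuous part in the Lebesgue decomposition of `ν` with respect to `μ`
exists and is nonzero. -/
def HasNonzeroACComponent {X : Type*} [MeasurableSpace X] (ν μ : Measure X) : Prop :=
  ∃ νac νs : Measure X, ν = νac + νs ∧ νac ≪ μ ∧ νs ⟂ₘ μ ∧ νac ≠ 0

end Switching

end

open Set MeasureTheory ProbabilityTheory
open scoped Manifold ContDiff

noncomputable section

namespace Switching

/-! ### Smooth dependence of solutions of ordinary differential equations on initial conditions -/

section Nemytskii

open Topology

variable {K : Type*} [TopologicalSpace K] [CompactSpace K]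

/-- Pointwise application of a continuous family of operators to a continuous function. -/
def pointwiseApply (K : Type*) [TopologicalSpace K] [CompactSpace K]
    (E F : Type*) [NormedAddCommGroup E] [NormedSpace ℝ E]
    [NormedAddCommGroup F] [NormedSpace ℝ F] :
    C(K, E →L[ℝ] F) →L[ℝ] C(K, E) →L[ℝ] C(K, F) :=
  LinearMap.mkContinuous₂
    (LinearMap.mk₂ ℝ (fun (A : C(K, E →L[ℝ] F)) (h : C(K, E)) =>
        (⟨fun s => A s (h s), by fun_prop⟩ : C(K, F)))
      (fun A B h => by ext s; simp) (fun c A h => by ext s; simp)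
      (fun A h h' => by ext s; simp) (fun c A h => by ext s; simp)) 1 (by
    intro A h
    rw [one_mul]
    refine (ContinuousMap.norm_le _ (by positivity)).2 fun s => ?_
    refine ((A s).le_opNorm (h s)).trans ?_
    gcongr
    · exact A.norm_coe_le_norm s
    · exact h.norm_coe_le_norm s)

lemma pointwiseApply_apply {E F : Type*} [NormedAddCommGroup E] [NormedSpace ℝ E]
    [NormedAddCommGroup F] [NormedSpace ℝ F] (A : C(K, E →L[ℝ] F)) (h : C(K, E)) (s : K) :
    pointwiseApply K E F A h s = A s (h s) := rfl

lemma hasFDerivAt_continuousMap_comp {E F : Type*} [NormedAddCommGroup E] [NormedSpace ℝ E]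
    [NormedAddCommGroup F] [NormedSpace ℝ F] (v : C(E, F)) (v' : C(E, E →L[ℝ] F))
    (hv : ∀ x, HasFDerivAt v (v' x) x) (γ : C(K, E)) :
    HasFDerivAt (fun γ : C(K, E) => v.comp γ) (pointwiseApply K E F (v'.comp γ)) γ := by
  have hc : Continuous fun γ : C(K, E) => v'.comp γ := ContinuousMap.continuous_postcomp v'
  rw [hasFDerivAt_iff_isLittleO_nhds_zero, Asymptotics.isLittleO_iff]
  intro c hc0
  obtain ⟨δ, hδ, hball⟩ := Metric.continuousAt_iff (f := fun γ : C(K, E) => v'.comp γ) (a := γ).1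
    hc.continuousAt c hc0
  filter_upwards [Metric.ball_mem_nhds (0 : C(K, E)) hδ] with h hh
  have hh' : ‖h‖ < δ := by simpa using hh
  refine (ContinuousMap.norm_le _ (by positivity)).2 fun s => ?_
  -- A point of the segment is the value at `s` of the path `γ + θ • h`, which is `δ`-close to `γ`.
  -- Continuity of `γ ↦ v' ∘ γ` in the sup norm thus gives a bound uniform in `s`.
  have key : ∀ y ∈ segment ℝ (γ s) (γ s + h s), ‖v' y - v' (γ s)‖ ≤ c := by
    intro y hy
    rw [segment_eq_image'] at hy
    obtain ⟨θ, hθ, rfl⟩ := hy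
    have hd : dist (γ + θ • h) γ < δ := by
      rw [dist_eq_norm, add_sub_cancel_left, norm_smul, Real.norm_of_nonneg hθ.1]
      calc θ * ‖h‖ ≤ 1 * ‖h‖ := by gcongr; exact hθ.2
        _ < δ := by simpa using hh'
    have := (ContinuousMap.dist_apply_le_dist s).trans (hball hd).le
    simpa [dist_eq_norm] using this
  have hmv := (convex_segment (𝕜 := ℝ) (γ s) (γ s + h s)).norm_image_sub_le_of_norm_hasFDerivWithin_le'
    (f := v) (φ := v' (γ s)) (fun y _ => (hv y).hasFDerivWithinAt) key
    (left_mem_segment ..) (right_mem_segment ..)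
  calc _ = ‖v (γ s + h s) - v (γ s) - v' (γ s) (γ s + h s - γ s)‖ := by
          simp [pointwiseApply_apply]
    _ ≤ c * ‖γ s + h s - γ s‖ := hmv
    _ ≤ c * ‖h‖ := by
        gcongr
        simpa using h.norm_coe_le_norm s

/-- Composition with a smooth map is a smooth operator between spaces of continuous functions. -/
lemma contDiff_continuousMap_comp.{u} (k : ℕ) {E : Type u} [NormedAddCommGroup E]
    [NormedSpace ℝ E] : ∀ {F : Type u} [NormedAddCommGroup F] [NormedSpace ℝ F] (v : C(E, F)), ContDiff ℝ k v →
      ContDiff ℝ k (fun γ : C(K, E) => v.comp γ) := by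
  induction k with
  | zero =>
    intro F _ _ v _
    exact contDiff_zero.2 (ContinuousMap.continuous_postcomp v)
  | succ k ih =>
    intro F _ _ v hv
    obtain ⟨v', hv', hd⟩ := (contDiff_succ_iff_hasFDerivAt (n := k)).1 (by exact_mod_cast hv)
    -- The target changes from `F` to `E →L[ℝ] F` here, which is why `E` and `F` share one universe
    -- and `F` is quantified inside the induction.
    have := ih ⟨v', hv'.continuous⟩ hv'
    have hB := ContinuousLinearMap.contDiff (𝕜 := ℝ) (n := k)
      (E := C(K, E →L[ℝ] F)) (F := C(K, E) →L[ℝ] C(K, F)) (pointwiseApply K E F)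
    exact_mod_cast (contDiff_succ_iff_hasFDerivAt (n := k)).2
      ⟨fun γ => pointwiseApply K E F ((⟨v', hv'.continuous⟩ : C(E, E →L[ℝ] F)).comp γ),
        ContDiff.comp (g := pointwiseApply K E F) hB this, fun γ =>
          hasFDerivAt_continuousMap_comp v ⟨v', hv'.continuous⟩ hd γ⟩

/-- The constant functions on the unit interval. -/
def constCLM (E : Type*) [NormedAddCommGroup E] [NormedSpace ℝ E] :
    E →L[ℝ] C(Icc (0 : ℝ) 1, E) :=
  LinearMap.mkContinuous
    { toFun := fun x => ContinuousMap.const _ x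
      map_add' := fun _ _ => rfl
      map_smul' := fun _ _ => rfl } 1 (by
    intro x
    exact (ContinuousMap.norm_le _ (by positivity)).2 fun _ => (one_mul ‖x‖).ge)

lemma constCLM_apply {E : Type*} [NormedAddCommGroup E] [NormedSpace ℝ E] (x : E)
    (s : Icc (0 : ℝ) 1) : constCLM E x s = x := rfl

end Nemytskii

/-! ### Local flows from the inverse function theorem -/

section LocalFlow

open Topology Filter

variable {E : Type*} [NormedAddCommGroup E] [NormedSpace ℝ E] [CompleteSpace E]

/-- The primitive `s ↦ ∫₀ˢ γ` of a continuous function on the unit interval. -/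
def primitive (E : Type*) [NormedAddCommGroup E] [NormedSpace ℝ E] [CompleteSpace E] :
    C(Icc (0 : ℝ) 1, E) →L[ℝ] C(Icc (0 : ℝ) 1, E) :=
  LinearMap.mkContinuous
    { toFun := fun γ => ⟨fun s => ∫ r in (0 : ℝ)..s, IccExtend zero_le_one γ r, by
        have : Continuous fun s : ℝ => ∫ r in (0 : ℝ)..s, IccExtend zero_le_one γ r :=
          intervalIntegral.continuous_primitive
            (fun a b => (γ.continuous.Icc_extend').intervalIntegrable a b) 0
        exact this.comp continuous_subtype_val⟩
      map_add' := fun γ δ => by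
        ext s
        exact intervalIntegral.integral_add ((γ.continuous.Icc_extend').intervalIntegrable _ _)
          ((δ.continuous.Icc_extend').intervalIntegrable _ _)
      map_smul' := fun c γ => by
        ext s
        exact intervalIntegral.integral_smul _ _ } 1 (by
    intro γ
    refine (ContinuousMap.norm_le _ (by positivity)).2 fun s => ?_
    have := intervalIntegral.norm_integral_le_of_norm_le_const (a := (0 : ℝ)) (b := s)
      (f := IccExtend zero_le_one γ) (C := ‖γ‖) (fun x _ => γ.norm_coe_le_norm _)
    refine this.trans ?_
    rw [sub_zero, abs_of_nonneg s.2.1, mul_comm]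
    gcongr
    exact s.2.2)

/-- The map whose zeros `γ` are the solutions of `γ' = t v(γ)`, `γ(0) = x` on the unit
interval, together with its parameters `(t, x)`. -/
def odeMap (v : C(E, E)) (z : (ℝ × E) × C(Icc (0 : ℝ) 1, E)) :
    (ℝ × E) × C(Icc (0 : ℝ) 1, E) :=
  (z.1, z.2 - constCLM E z.1.2 - z.1.1 • primitive E (v.comp z.2))

lemma contDiff_odeMap {k : ℕ} (v : C(E, E)) (hv : ContDiff ℝ k v) : ContDiff ℝ k (odeMap v) := by
  have h1 : ContDiff ℝ k (fun z : (ℝ × E) × C(Icc (0 : ℝ) 1, E) => v.comp z.2) :=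
    (contDiff_continuousMap_comp k v hv).comp contDiff_snd
  have h2 := (primitive E).contDiff.comp h1
  have h3 : ContDiff ℝ k (fun z : (ℝ × E) × C(Icc (0 : ℝ) 1, E) => constCLM E z.1.2) :=
    (constCLM E).contDiff.comp (by fun_prop)
  exact contDiff_fst.prodMk ((contDiff_snd.sub h3).sub ((by fun_prop : ContDiff ℝ k
    fun z : (ℝ × E) × C(Icc (0 : ℝ) 1, E) => z.1.1).smul h2))

/-- The derivative of `odeMap` at time zero and a constant path. -/
def odeMapDeriv (w : C(Icc (0 : ℝ) 1, E)) :
    ((ℝ × E) × C(Icc (0 : ℝ) 1, E)) ≃L[ℝ] ((ℝ × E) × C(Icc (0 : ℝ) 1, E)) :=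
  ContinuousLinearEquiv.equivOfInverse
    ((ContinuousLinearMap.fst ℝ _ _).prod (ContinuousLinearMap.snd ℝ _ _ -
      ((constCLM E).comp (ContinuousLinearMap.snd ℝ ℝ E) +
        (ContinuousLinearMap.fst ℝ ℝ E).smulRight w).comp (ContinuousLinearMap.fst ℝ _ _)))
    ((ContinuousLinearMap.fst ℝ _ _).prod (ContinuousLinearMap.snd ℝ _ _ +
      ((constCLM E).comp (ContinuousLinearMap.snd ℝ ℝ E) +
        (ContinuousLinearMap.fst ℝ ℝ E).smulRight w).comp (ContinuousLinearMap.fst ℝ _ _)))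
    (fun z => by ext <;> simp) (fun z => by ext <;> simp)

/-- At `t = 0` the integral term contributes only through the variation of `t`, so the derivative is
the identity in the path and triangular overall. It is therefore invertible, however large the
derivative of `v` is. -/
lemma hasFDerivAt_odeMap (v : C(E, E)) (hv : ContDiff ℝ 1 v) (x₀ : E) :
    HasFDerivAt (odeMap v) (odeMapDeriv (primitive E (v.comp (constCLM E x₀))) :
      ((ℝ × E) × C(Icc (0 : ℝ) 1, E)) →L[ℝ] ((ℝ × E) × C(Icc (0 : ℝ) 1, E)))
      ((0, x₀), constCLM E x₀) := by
  have h1 : ContDiff ℝ 1 (fun z : (ℝ × E) × C(Icc (0 : ℝ) 1, E) => primitive E (v.comp z.2)) :=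
    (primitive E).contDiff.comp
      ((contDiff_continuousMap_comp 1 v (by exact_mod_cast hv)).comp contDiff_snd)
  have h2 := (h1.differentiable one_ne_zero ((0, x₀), constCLM E x₀)).hasFDerivAt
  have h3 : HasFDerivAt (fun z : (ℝ × E) × C(Icc (0 : ℝ) 1, E) => z.1.1)
    ((ContinuousLinearMap.fst ℝ ℝ E).comp (ContinuousLinearMap.fst ℝ _ _))
    ((0, x₀), constCLM E x₀) := hasFDerivAt_fst.comp (g := Prod.fst) _ hasFDerivAt_fst
  have h4 : HasFDerivAt (fun z : (ℝ × E) × C(Icc (0 : ℝ) 1, E) => constCLM E z.1.2)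
    (((constCLM E).comp (ContinuousLinearMap.snd ℝ ℝ E)).comp (ContinuousLinearMap.fst ℝ _ _))
    ((0, x₀), constCLM E x₀) := ((constCLM E).comp (ContinuousLinearMap.snd ℝ ℝ E)).hasFDerivAt.comp
      _ hasFDerivAt_fst
  refine (hasFDerivAt_fst.prodMk ((hasFDerivAt_snd.sub h4).sub (h3.smul h2))).congr_fderiv ?_
  ext z <;> simp [odeMapDeriv]

lemma odeMap_eq_iff {v : C(E, E)} {t : ℝ} {x : E} {z : (ℝ × E) × C(Icc (0 : ℝ) 1, E)} :
    odeMap v z = ((t, x), 0) ↔ z.1 = (t, x) ∧ ∀ s : Icc (0 : ℝ) 1,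
      z.2 s = x + t • ∫ r in (0 : ℝ)..s, v (IccExtend zero_le_one z.2 r) := by
  obtain ⟨⟨t', x'⟩, γ⟩ := z
  simp only [odeMap, Prod.mk.injEq, sub_sub, sub_eq_zero]
  constructor
  · rintro ⟨⟨rfl, rfl⟩, h⟩
    exact ⟨⟨rfl, rfl⟩, fun s => congrArg (fun δ : C(Icc (0 : ℝ) 1, E) => δ s) h⟩
  · rintro ⟨⟨rfl, rfl⟩, h⟩
    exact ⟨⟨rfl, rfl⟩, ContinuousMap.ext h⟩

/-- A smooth vector field has a local flow that is twice continuously differentiable. -/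
theorem exists_local_flow_of_contDiff (v : C(E, E)) (hv : ContDiff ℝ 2 v) (x₀ : E) :
    ∃ ψ : ℝ × E → E, ContDiffAt ℝ 2 ψ (0, x₀) ∧ ∃ ε > 0, ∃ W ∈ 𝓝 x₀, ∀ x ∈ W,
      ψ (0, x) = x ∧ ∀ t ∈ Ioo (-ε) ε, HasDerivAt (fun s => ψ (s, x)) (v (ψ (t, x))) t := by
  have hF : ContDiffAt ℝ 2 (odeMap v) ((0, x₀), constCLM E x₀) :=
    (contDiff_odeMap (k := 2) v (by exact_mod_cast hv)).contDiffAt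
  have hF' := hasFDerivAt_odeMap v (hv.of_le one_le_two) x₀
  have hF0 : odeMap v ((0, x₀), constCLM E x₀) = ((0, x₀), 0) :=
    odeMap_eq_iff.2 ⟨rfl, fun s => by simp [constCLM_apply]⟩
  set g := hF.localInverse hF' two_ne_zero with hg
  have hgc : ContDiffAt ℝ 2 g ((0, x₀), 0) := hF0 ▸ hF.to_localInverse hF' two_ne_zero
  have hg0 : g ((0, x₀), 0) = ((0, x₀), constCLM E x₀) := by
    rw [← hF0]; exact hF.localInverse_apply_image hF' two_ne_zero
  have hstrict := hF.hasStrictFDerivAt' hF' two_ne_zero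
  have hleft : ∀ᶠ z in 𝓝 ((0, x₀), constCLM E x₀), g (odeMap v z) = z :=
    hstrict.eventually_left_inverse
  have hright : ∀ᶠ y in 𝓝 (((0 : ℝ), x₀), (0 : C(Icc (0 : ℝ) 1, E))), odeMap v (g y) = y := by
    rw [← hF0]; exact hstrict.eventually_right_inverse
  -- `G (t, x)` is the solution path started at `x`, run over the time `t` and rescaled to the unit
  -- interval. The flow is its value at `1`.
  set G : ℝ × E → C(Icc (0 : ℝ) 1, E) := fun y => (g (y, 0)).2 with hG
  have hGc : ContDiffAt ℝ 2 G (0, x₀) :=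
    ContDiffAt.snd (hgc.comp (g := g) (f := fun y : ℝ × E => (y, (0 : C(Icc (0 : ℝ) 1, E)))) (0, x₀)
      (by fun_prop))
  have hG0 : G (0, x₀) = constCLM E x₀ := by simp [hG, hg0]
  -- the integral equation near the base point
  have heq : ∀ᶠ y in 𝓝 ((0 : ℝ), x₀), ∀ s : Icc (0 : ℝ) 1,
      G y s = y.2 + y.1 • ∫ r in (0 : ℝ)..s, v (IccExtend zero_le_one (G y) r) := by
    have hc : Tendsto (fun y : ℝ × E => (y, (0 : C(Icc (0 : ℝ) 1, E)))) (𝓝 (0, x₀))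
        (𝓝 ((0, x₀), 0)) := (by fun_prop : Continuous _).tendsto _
    filter_upwards [hc.eventually hright] with y hy
    exact (odeMap_eq_iff.1 hy).2
  obtain ⟨r, hr, hball⟩ := Metric.eventually_nhds_iff.1 hleft
  have hGnear : ∀ᶠ y in 𝓝 ((0 : ℝ), x₀), dist (G y) (constCLM E x₀) < r := by
    have := hGc.continuousAt.tendsto
    rw [hG0] at this
    exact this.eventually (Metric.ball_mem_nhds _ hr)
  have hynear : ∀ᶠ y in 𝓝 ((0 : ℝ), x₀), dist y (0, x₀) < r := Metric.ball_mem_nhds _ hr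
  have hdiff : ∀ᶠ y in 𝓝 ((0 : ℝ), x₀), ContDiffAt ℝ 2 G y := hGc.eventually (by simp)
  obtain ⟨ε, hε, hall⟩ := Metric.eventually_nhds_iff.1
    (heq.and (hGnear.and (hynear.and hdiff)))
  let one' : Icc (0 : ℝ) 1 := ⟨1, by simp⟩
  let zero' : Icc (0 : ℝ) 1 := ⟨0, by simp⟩
  let ev : C(Icc (0 : ℝ) 1, E) →L[ℝ] E := ContinuousMap.evalCLM ℝ one'
  refine ⟨fun y => G y one', ContDiffAt.comp (g := ev) _ ev.contDiff.contDiffAt hGc, ε, hε,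
    Metric.ball x₀ ε, Metric.ball_mem_nhds _ hε, fun x hx => ?_⟩
  have hmem : ∀ t ∈ Ioo (-ε) ε, dist (t, x) (0, x₀) < ε := fun t ht => by
    rw [Prod.dist_eq, Real.dist_eq, sub_zero]
    exact max_lt (abs_lt.2 ht) hx
  have h0mem : (0 : ℝ) ∈ Ioo (-ε) ε := ⟨by linarith, hε⟩
  -- rescaling the path
  have hscale : ∀ t ∈ Ioo (-ε) ε, ∀ s : Icc (0 : ℝ) 1, G (t, x) s = G (s * t, x) one' := by
    intro t ht s
    obtain ⟨h1, h2, h3, -⟩ := hall (hmem t ht)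
    let δ : C(Icc (0 : ℝ) 1, E) := ⟨fun q => G (t, x) ⟨s * q, mul_nonneg s.2.1 q.2.1,
      mul_le_one₀ s.2.2 q.2.1 q.2.2⟩, by fun_prop⟩
    have hδ : odeMap v ((s * t, x), δ) = ((s * t, x), 0) := by
      refine odeMap_eq_iff.2 ⟨rfl, fun q => ?_⟩
      have hq := h1 ⟨s * q, mul_nonneg s.2.1 q.2.1, mul_le_one₀ s.2.2 q.2.1 q.2.2⟩
      change G (t, x) ⟨s * q, _⟩ = _
      rw [hq]
      simp only [add_right_inj]
      rw [mul_comm (s : ℝ) t, mul_smul]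
      congr 1
      have := intervalIntegral.smul_integral_comp_mul_left (a := 0) (b := (q : ℝ))
        (fun r => v (IccExtend zero_le_one (G (t, x)) r)) (s : ℝ)
      rw [mul_zero] at this
      rw [← this]
      congr 1
      refine intervalIntegral.integral_congr fun p hp => ?_
      rw [uIcc_of_le q.2.1] at hp
      have hp' : p ∈ Icc (0 : ℝ) 1 := ⟨hp.1, hp.2.trans q.2.2⟩
      have hp'' : (s : ℝ) * p ∈ Icc (0 : ℝ) 1 :=
        ⟨mul_nonneg s.2.1 hp'.1, mul_le_one₀ s.2.2 hp'.1 hp'.2⟩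
      simp only [IccExtend_of_mem _ _ hp', IccExtend_of_mem _ _ hp'']
      rfl
    -- The left inverse acts as local uniqueness: a solution of the integral equation close enough
    -- to the base point is the one given by `G`.
    have hst : dist (((s : ℝ) * t, x), δ) ((0, x₀), constCLM E x₀) < r := by
      rw [Prod.dist_eq, Prod.dist_eq]
      refine max_lt (max_lt ?_ ?_) ?_
      · refine lt_of_le_of_lt ?_ ((le_max_left _ _).trans_lt ((Prod.dist_eq (x := (t, x))
          (y := ((0 : ℝ), x₀))).symm.trans_lt h3))
        rw [Real.dist_eq, Real.dist_eq, sub_zero, sub_zero, abs_mul, abs_of_nonneg s.2.1]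
        exact mul_le_of_le_one_left (abs_nonneg _) s.2.2
      · exact (le_max_right _ _).trans_lt ((Prod.dist_eq (x := (t, x))
          (y := ((0 : ℝ), x₀))).symm.trans_lt h3)
      · refine (ContinuousMap.dist_lt_iff hr).2 fun q => ?_
        exact (ContinuousMap.dist_apply_le_dist (f := G (t, x)) (g := constCLM E x₀) _).trans_lt h2
    have := hball hst
    rw [hδ] at this
    have h5 : G (s * t, x) = δ := congrArg Prod.snd this
    rw [h5]
    change _ = G (t, x) ⟨s * 1, _⟩
    simp
  -- the integral equation for the flow
  have hint : ∀ t ∈ Ioo (-ε) ε,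
      G (t, x) one' = x + ∫ q in (0 : ℝ)..t, v (G (q, x) one') := by
    intro t ht
    rw [(hall (hmem t ht)).1 one']
    simp only [add_right_inj]
    have := intervalIntegral.smul_integral_comp_mul_right (a := 0) (b := 1)
      (fun q => v (G (q, x) one')) t
    rw [zero_mul, one_mul] at this
    rw [← this]
    congr 1
    refine intervalIntegral.integral_congr fun p hp => ?_
    rw [uIcc_of_le zero_le_one] at hp
    simp only [IccExtend_of_mem _ _ hp]
    rw [hscale t ht]
  have hcont : ContinuousOn (fun q => v (G (q, x) one')) (Ioo (-ε) ε) := by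
    intro t ht
    have h1 := (hall (hmem t ht)).2.2.2.continuousAt
    have h2 : ContinuousAt (fun q : ℝ => G (q, x)) t :=
      ContinuousAt.comp (g := G) h1 (by fun_prop)
    exact (v.continuous.continuousAt.comp (ev.continuous.continuousAt.comp h2)).continuousWithinAt
  refine ⟨by simpa using hint 0 h0mem, fun t ht => ?_⟩
  have hsub : uIcc 0 t ⊆ Ioo (-ε) ε := (ordConnected_Ioo).uIcc_subset h0mem ht
  have hd := intervalIntegral.integral_hasDerivAt_right
    ((hcont.mono hsub).intervalIntegrable) (hcont.stronglyMeasurableAtFilter isOpen_Ioo t ht)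
    (hcont.continuousAt (Ioo_mem_nhds ht.1 ht.2))
  refine (hd.const_add x).congr_of_eventuallyEq ?_
  filter_upwards [Ioo_mem_nhds ht.1 ht.2] with q hq
  exact hint q hq

/-- A vector field that is smooth on an open set has a local flow that is twice continuously
differentiable. -/
theorem exists_local_flow [FiniteDimensional ℝ E] {v : E → E} {O : Set E} {x₀ : E}
    (hO : IsOpen O) (hx₀ : x₀ ∈ O) (hv : ContDiffOn ℝ ∞ v O) :
    ∃ ψ : ℝ × E → E, ∃ ε > 0, ∃ W ∈ 𝓝 x₀, ∀ x ∈ W, ψ (0, x) = x ∧ ∀ t ∈ Ioo (-ε) ε,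
      ContDiffAt ℝ 2 ψ (t, x) ∧ ψ (t, x) ∈ O ∧
        HasDerivAt (fun s => ψ (s, x)) (v (ψ (t, x))) t := by
  obtain ⟨r, hr, hrO⟩ := Metric.isOpen_iff.1 hO x₀ hx₀
  -- The cutoff makes the field globally C². It equals `1` on the ball of radius `r / 4`, where the
  -- local flow is kept, so the original field is recovered along the flow.
  let b : ContDiffBump x₀ := ⟨r / 4, r / 2, by positivity, by linarith⟩
  have hw : ContDiff ℝ 2 (fun x => b x • v x) := by
    rw [contDiff_iff_contDiffAt]
    intro x
    by_cases hx : x ∈ O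
    · exact b.contDiff.contDiffAt.smul ((hv.contDiffAt (hO.mem_nhds hx)).of_le (by exact_mod_cast le_top))
    · have h0 : (fun x => b x • v x) =ᶠ[𝓝 x] fun _ => 0 := by
        have hx' : x ∈ (tsupport b)ᶜ := by
          rw [b.tsupport_eq]
          intro h
          exact hx (hrO (lt_of_le_of_lt (Metric.mem_closedBall.1 h) (half_lt_self hr)))
        filter_upwards [(isClosed_tsupport _).isOpen_compl.mem_nhds hx'] with y hy
        simp [image_eq_zero_of_notMem_tsupport hy]
      exact contDiffAt_const.congr_of_eventuallyEq h0
  obtain ⟨ψ, hψ, ε, hε, W, hW, h⟩ := exists_local_flow_of_contDiff ⟨_, hw.continuous⟩ hw x₀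
  have hψ0 : ψ (0, x₀) = x₀ := (h x₀ (mem_of_mem_nhds hW)).1
  have hnear : ∀ᶠ y in 𝓝 ((0 : ℝ), x₀), dist (ψ y) x₀ < r / 4 := by
    have := hψ.continuousAt.tendsto
    rw [hψ0] at this
    exact this.eventually (Metric.ball_mem_nhds _ (by positivity))
  obtain ⟨ε', hε', hall⟩ := Metric.eventually_nhds_iff.1 (hnear.and (hψ.eventually (by simp)))
  refine ⟨ψ, min ε ε', lt_min hε hε', W ∩ Metric.ball x₀ ε',
    Filter.inter_mem hW (Metric.ball_mem_nhds _ hε'), fun x hx => ⟨(h x hx.1).1, fun t ht => ?_⟩⟩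
  have hmem : dist (t, x) (0, x₀) < ε' := by
    rw [Prod.dist_eq, Real.dist_eq, sub_zero]
    exact max_lt ((abs_lt.2 ht).trans_le (min_le_right _ _)) hx.2
  obtain ⟨h1, h2⟩ := hall hmem
  refine ⟨h2, hrO (Metric.mem_ball.2 (by linarith)), ?_⟩
  have h3 := (h x hx.1).2 t ⟨(neg_le_neg (min_le_left _ _)).trans_lt ht.1,
    ht.2.trans_le (min_le_left _ _)⟩
  simpa [b.one_of_mem_closedBall (Metric.mem_closedBall.2 h1.le)] using h3

end LocalFlow

/-! ### Vector fields in a chart -/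

section ChartField

open Topology Filter VectorField

variable {n : ℕ} {M : Type*} [TopologicalSpace M] [ChartedSpace (EuclideanSpace ℝ (Fin n)) M]

lemma two_le_infty : (2 : ℕ∞ω) ≤ ∞ := 
  show ((2 : ℕ∞) : ℕ∞ω) ≤ ((⊤ : ℕ∞) : ℕ∞ω) from WithTop.coe_le_coe.2 le_top

/-- The representation of a vector field in the chart at `ξ`. -/
def chartField (ξ : M) (v : (x : M) → TangentSpace (𝓡 n) x) :
    EuclideanSpace ℝ (Fin n) → EuclideanSpace ℝ (Fin n) :=
  mpullback 𝓘(ℝ, EuclideanSpace ℝ (Fin n)) (𝓡 n) (extChartAt (𝓡 n) ξ).symm v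

lemma chartField_add (ξ : M) (v w : (x : M) → TangentSpace (𝓡 n) x) :
    chartField ξ (v + w) = chartField ξ v + chartField ξ w := mpullback_add

lemma chartField_smul (ξ : M) (c : ℝ) (v : (x : M) → TangentSpace (𝓡 n) x) :
    chartField ξ (c • v) = c • chartField ξ v := mpullback_const_smul

lemma chartField_zero (ξ : M) :
    chartField ξ (0 : (x : M) → TangentSpace (𝓡 n) x) = 0 := mpullback_zero

variable [IsManifold (𝓡 n) ∞ M]

lemma isManifold_minSmoothness : IsManifold (𝓡 n) (minSmoothness ℝ 2) M := by
  rw [minSmoothness_of_isRCLikeNormedField]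
  exact IsManifold.of_le (n := ∞) two_le_infty

lemma contMDiffAt_extChartAt_symm' {ξ : M} {x : EuclideanSpace ℝ (Fin n)}
    (hx : x ∈ (extChartAt (𝓡 n) ξ).target) :
    ContMDiffAt 𝓘(ℝ, EuclideanSpace ℝ (Fin n)) (𝓡 n) ∞ (extChartAt (𝓡 n) ξ).symm x :=
  (contMDiffOn_extChartAt_symm ξ).contMDiffAt ((isOpen_extChartAt_target ξ).mem_nhds hx)

lemma isInvertible_mfderiv_extChartAt_symm' {ξ : M} {x : EuclideanSpace ℝ (Fin n)}
    (hx : x ∈ (extChartAt (𝓡 n) ξ).target) :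
    (mfderiv 𝓘(ℝ, EuclideanSpace ℝ (Fin n)) (𝓡 n) (extChartAt (𝓡 n) ξ).symm x).IsInvertible := by
  have := isInvertible_mfderivWithin_extChartAt_symm (I := 𝓡 n) hx
  rwa [ModelWithCorners.range_eq_univ, mfderivWithin_univ] at this

lemma mfderiv_symm_chartField {ξ : M} (v : (x : M) → TangentSpace (𝓡 n) x)
    {x : EuclideanSpace ℝ (Fin n)} (hx : x ∈ (extChartAt (𝓡 n) ξ).target) :
    mfderiv 𝓘(ℝ, EuclideanSpace ℝ (Fin n)) (𝓡 n) (extChartAt (𝓡 n) ξ).symm x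
      (chartField ξ v x) = v ((extChartAt (𝓡 n) ξ).symm x) :=
  (isInvertible_mfderiv_extChartAt_symm' hx).self_apply_inverse _

lemma contDiffOn_chartField {v : (x : M) → TangentSpace (𝓡 n) x} (hv : IsSmoothField v) (ξ : M) :
    ContDiffOn ℝ ∞ (chartField ξ v) (extChartAt (𝓡 n) ξ).target := by
  intro x hx
  have := ContMDiffAt.mpullback_vectorField_preimage (m := ∞) (n := ∞)
    (hv ((extChartAt (𝓡 n) ξ).symm x)) (contMDiffAt_extChartAt_symm' hx)
    (isInvertible_mfderiv_extChartAt_symm' hx) (by simp)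
  exact (contMDiffAt_vectorSpace_iff_contDiffAt.1 this).contDiffWithinAt

/-- Brackets are natural under pullback by the inverse chart, which on the target is smooth with
invertible derivative. Bracket computations thereby move to Euclidean space. -/
lemma chartField_mlieBracket {v w : (x : M) → TangentSpace (𝓡 n) x} (hv : IsSmoothField v)
    (hw : IsSmoothField w) {ξ : M} {x : EuclideanSpace ℝ (Fin n)}
    (hx : x ∈ (extChartAt (𝓡 n) ξ).target) :
    chartField ξ (mlieBracket (𝓡 n) v w) x =
      lieBracket ℝ (chartField ξ v) (chartField ξ w) x := by
  have := isManifold_minSmoothness (n := n) (M := M)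
  have := mpullback_mlieBracket (I := 𝓘(ℝ, EuclideanSpace ℝ (Fin n))) (I' := 𝓡 n)
    (f := (extChartAt (𝓡 n) ξ).symm) (n := ∞)
    ((hv ((extChartAt (𝓡 n) ξ).symm x)).mdifferentiableAt (by simp))
    ((hw ((extChartAt (𝓡 n) ξ).symm x)).mdifferentiableAt (by simp))
    (contMDiffAt_extChartAt_symm' hx) (by simpa using two_le_infty)
  rw [chartField, this, ← mlieBracketWithin_univ, mlieBracketWithin_eq_lieBracketWithin]
  exact congrFun lieBracketWithin_univ x

lemma IsSmoothField.mlieBracket {v w : (x : M) → TangentSpace (𝓡 n) x} (hv : IsSmoothField v)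
    (hw : IsSmoothField w) : IsSmoothField (mlieBracket (𝓡 n) v w) := by
  have := isManifold_minSmoothness (n := n) (M := M)
  have : IsManifold (𝓡 n) (((⊤ : ℕ∞) : ℕ∞ω) + 1) M := inferInstanceAs (IsManifold (𝓡 n) ∞ M)
  exact ContDiff.mlieBracket_vectorField (n := ⊤) (m := ⊤) hv hw (by simp)

lemma hasMFDerivWithinAt_symm_comp {v : (x : M) → TangentSpace (𝓡 n) x} {ξ : M}
    {c : ℝ → EuclideanSpace ℝ (Fin n)} {s : Set ℝ} {t : ℝ}
    (hc : HasDerivWithinAt c (chartField ξ v (c t)) s t)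
    (ht : c t ∈ (extChartAt (𝓡 n) ξ).target) :
    HasMFDerivWithinAt 𝓘(ℝ, ℝ) (𝓡 n) ((extChartAt (𝓡 n) ξ).symm ∘ c) s t
      ((1 : ℝ →L[ℝ] ℝ).smulRight (v (((extChartAt (𝓡 n) ξ).symm ∘ c) t))) := by
  have h1 := ((contMDiffAt_extChartAt_symm' ht).mdifferentiableAt (by simp)).hasMFDerivAt
  have h2 := HasMFDerivAt.comp_hasMFDerivWithinAt t h1 hc.hasFDerivWithinAt.hasMFDerivWithinAt
  refine h2.congr_mfderiv ?_
  refine ContinuousLinearMap.ext_ring ?_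
  exact (congrArg (fun e => mfderiv 𝓘(ℝ, EuclideanSpace ℝ (Fin n)) (𝓡 n) (extChartAt (𝓡 n) ξ).symm
    (c t) e) (one_smul ℝ (chartField ξ v (c t)))).trans
    ((mfderiv_symm_chartField v ht).trans (one_smul ℝ (v _)).symm)

end ChartField

/-! ### Forward flows on the manifold: uniqueness, semigroup property, continuity -/

section Flow

open Topology Filter

variable {n : ℕ} {M : Type*} [TopologicalSpace M] [ChartedSpace (EuclideanSpace ℝ (Fin n)) M]
  {v : (x : M) → TangentSpace (𝓡 n) x}

/-- A solution on `[0, T)` extends to a solution on an open interval around `0`. -/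
lemma exists_extension_left {γ : ℝ → M} {T : ℝ} (hT : 0 < T)
    (hγ : IsMIntegralCurveOn γ v (Ico 0 T)) {β : ℝ → M} {ε : ℝ} (hε : 0 < ε)
    (hβ : IsMIntegralCurveOn β v (Metric.ball 0 ε)) (h0 : β 0 = γ 0) :
    IsMIntegralCurveOn (fun t => if t < 0 then β t else γ t) v (Ioo (-ε) T) := by
  set δ : ℝ → M := fun t => if t < 0 then β t else γ t with hδ
  have hβ' : ∀ t ∈ Ioo (-ε) ε, HasMFDerivAt 𝓘(ℝ, ℝ) (𝓡 n) β t
      ((1 : ℝ →L[ℝ] ℝ).smulRight (v (β t))) := fun t ht =>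
    (hβ t (by rw [Metric.mem_ball, Real.dist_eq, sub_zero]; exact abs_lt.2 ht)).hasMFDerivAt
      (Metric.isOpen_ball.mem_nhds (by rw [Metric.mem_ball, Real.dist_eq, sub_zero]; exact abs_lt.2 ht))
  intro t ht
  rcases lt_trichotomy t 0 with h | h | h
  · have he : δ =ᶠ[𝓝 t] β := by
      filter_upwards [Iio_mem_nhds h] with s hs
      exact if_pos hs
    have : δ t = β t := if_pos h
    rw [this]
    exact ((hβ' t ⟨ht.1, h.trans hε⟩).congr_of_eventuallyEq he).hasMFDerivWithinAt
  · subst h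
    have hd0 : δ 0 = γ 0 := if_neg (lt_irrefl 0)
    -- At the gluing time both one-sided derivatives equal the field at the common value.
    have h1 : HasMFDerivWithinAt 𝓘(ℝ, ℝ) (𝓡 n) δ (Iic 0) 0
        ((1 : ℝ →L[ℝ] ℝ).smulRight (v (δ 0))) := by
      rw [hd0, ← h0]
      refine (hβ' 0 ⟨by linarith, hε⟩).hasMFDerivWithinAt.congr_of_eventuallyEq ?_ (hd0.trans h0.symm)
      filter_upwards [self_mem_nhdsWithin] with s hs
      rcases (mem_Iic.1 hs).lt_or_eq with h | h
      · exact if_pos h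
      · rw [h, hd0, h0]
    have h2 : HasMFDerivWithinAt 𝓘(ℝ, ℝ) (𝓡 n) δ (Ici 0) 0
        ((1 : ℝ →L[ℝ] ℝ).smulRight (v (δ 0))) := by
      rw [hd0]
      refine ((hγ 0 ⟨le_rfl, hT⟩).mono_of_mem_nhdsWithin
        (Ico_mem_nhdsGE hT)).congr_of_eventuallyEq ?_ hd0
      filter_upwards [self_mem_nhdsWithin] with s hs
      exact if_neg (not_lt.2 hs)
    exact (h1.union h2).mono fun s _ => le_total s 0
  · have he : δ =ᶠ[𝓝 t] γ := by
      filter_upwards [Ioi_mem_nhds h] with s hs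
      exact if_neg (not_lt.2 (le_of_lt hs))
    have : δ t = γ t := if_neg (not_lt.2 h.le)
    rw [this]
    exact (((hγ t ⟨h.le, ht.2⟩).hasMFDerivAt (Ico_mem_nhds h ht.2)).congr_of_eventuallyEq
      he).hasMFDerivWithinAt

lemma _root_.IsMIntegralCurveOn.congr_eqOn {γ δ : ℝ → M} {s : Set ℝ}
    (h : IsMIntegralCurveOn γ v s) (he : EqOn δ γ s) : IsMIntegralCurveOn δ v s := by
  intro t ht
  rw [he ht]
  exact (h t ht).congr_of_eventuallyEq (by filter_upwards [self_mem_nhdsWithin] with r hr using he hr)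
    (he ht)

lemma flow_max (t : ℝ) (η : M) : flow v t η = flow v (max t 0) η := by
  simp [flow]

lemma isForwardSolution_flow (hc : ForwardComplete v) (η : M) :
    IsForwardSolution v η (fun t => flow v t η) := by
  have h := hc η
  have he : ∀ t, flow v t η = h.choose (max t 0) := fun t => by rw [flow, dif_pos h]
  obtain ⟨h0, h1⟩ := h.choose_spec
  refine ⟨by simp [he, h0], ?_⟩
  exact h1.congr_eqOn fun s hs => by rw [he, max_eq_left hs]

lemma flow_zero (hc : ForwardComplete v) (η : M) : flow v 0 η = η :=
  (isForwardSolution_flow hc η).1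

lemma flow_of_nonpos (hc : ForwardComplete v) {t : ℝ} (ht : t ≤ 0) (η : M) : flow v t η = η := by
  have h := flow_zero hc η
  simp only [flow] at h ⊢
  split_ifs at h ⊢ <;> simp_all

lemma continuous_flow_time (hc : ForwardComplete v) (η : M) : Continuous fun t => flow v t η := by
  have h : ContinuousOn (fun t => flow v t η) (Ici 0) := fun t ht =>
    ((isForwardSolution_flow hc η).2 t ht).continuousWithinAt
  have : (fun t => flow v t η) = fun t => flow v (max t 0) η := funext fun t => flow_max t η
  rw [this]
  exact h.comp_continuous (by fun_prop) fun t => mem_Ici.2 (le_max_right _ _)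

variable [IsManifold (𝓡 n) ∞ M] [T2Space M]

/-- Solutions on `[0, T)` are determined by their initial value. -/
lemma eqOn_of_isMIntegralCurveOn_Ico (hv : IsSmoothField v) {γ γ' : ℝ → M} {T : ℝ}
    (hγ : IsMIntegralCurveOn γ v (Ico 0 T)) (hγ' : IsMIntegralCurveOn γ' v (Ico 0 T))
    (h0 : γ 0 = γ' 0) : EqOn γ γ' (Ico 0 T) := by
  intro t ht
  have hT : 0 < T := ht.1.trans_lt ht.2
  have hv1 : ContMDiff (𝓡 n) (𝓡 n).tangent 1 (fun x => (⟨x, v x⟩ : TangentBundle (𝓡 n) M)) :=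
    hv.of_le (by simp)
  -- Both solutions are prolonged to negative times by the same local integral curve, so that
  -- uniqueness on an open interval around `0` applies.
  obtain ⟨β, hβ0, hβ⟩ := exists_isMIntegralCurveAt_of_contMDiffAt_boundaryless 0 (hv1 (γ 0))
  obtain ⟨ε, hε, hβ⟩ := isMIntegralCurveAt_iff'.1 hβ
  have : IsManifold (𝓡 n) 1 M := IsManifold.of_le (n := ∞) (by simp)
  have := isMIntegralCurveOn_Ioo_eqOn_of_contMDiff_boundaryless (t₀ := 0) ⟨by linarith, hT⟩ hv1
    (exists_extension_left hT hγ hε hβ hβ0)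
    (exists_extension_left hT hγ' hε hβ (hβ0.trans h0)) (by simp [h0])
    (x := t) ⟨by linarith [ht.1], ht.2⟩
  simpa [not_lt.2 ht.1] using this

lemma flow_eq_of_isMIntegralCurveOn (hv : IsSmoothField v) (hc : ForwardComplete v) {γ : ℝ → M}
    {T : ℝ} {η : M} (hγ : IsMIntegralCurveOn γ v (Ico 0 T)) (h0 : γ 0 = η) {t : ℝ}
    (ht : t ∈ Ico 0 T) : flow v t η = γ t := by
  have h := isForwardSolution_flow hc η
  exact eqOn_of_isMIntegralCurveOn_Ico hv (h.2.mono Ico_subset_Ici_self) hγ (h.1.trans h0.symm) ht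

lemma flow_add (hv : IsSmoothField v) (hc : ForwardComplete v) {s t : ℝ} (hs : 0 ≤ s) (ht : 0 ≤ t)
    (η : M) : flow v (s + t) η = flow v t (flow v s η) := by
  have h := ((isForwardSolution_flow hc η).2.comp_add s).mono
    (s' := Ico 0 (t + 1)) (fun r hr => add_nonneg hr.1 hs)
  rw [flow_eq_of_isMIntegralCurveOn hv hc h (by simp) ⟨ht, by linarith⟩]
  simp [add_comm]

/-- In a chart, the flow of a smooth field is given by a local flow for small positive times. -/
theorem exists_chart_flow (hv : IsSmoothField v) (hc : ForwardComplete v) (ξ : M) :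
    ∃ ψ : ℝ × EuclideanSpace ℝ (Fin n) → EuclideanSpace ℝ (Fin n),
      ∃ ε > 0, ∃ W ∈ 𝓝 (extChartAt (𝓡 n) ξ ξ), ∀ x ∈ W, ψ (0, x) = x ∧ ∀ t ∈ Ioo (-ε) ε,
        ContDiffAt ℝ 2 ψ (t, x) ∧ ψ (t, x) ∈ (extChartAt (𝓡 n) ξ).target ∧
        HasDerivAt (fun s => ψ (s, x)) (chartField ξ v (ψ (t, x))) t ∧
        (0 ≤ t → flow v t ((extChartAt (𝓡 n) ξ).symm x) =
          (extChartAt (𝓡 n) ξ).symm (ψ (t, x))) := by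
  obtain ⟨ψ, ε, hε, W, hW, h⟩ := exists_local_flow (isOpen_extChartAt_target ξ)
    (mem_extChartAt_target (I := 𝓡 n) ξ) (contDiffOn_chartField hv ξ)
  refine ⟨ψ, ε, hε, W, hW, fun x hx => ⟨(h x hx).1, fun t ht => ?_⟩⟩
  obtain ⟨h1, h2, h3⟩ := (h x hx).2 t ht
  refine ⟨h1, h2, h3, fun ht0 => ?_⟩
  refine flow_eq_of_isMIntegralCurveOn hv hc (γ := (extChartAt (𝓡 n) ξ).symm ∘ fun s => ψ (s, x))
    (T := ε) (fun s hs => ?_) (by simp [(h x hx).1]) ⟨ht0, ht.2⟩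
  obtain ⟨-, h5, h6⟩ := (h x hx).2 s ⟨by linarith [hs.1], hs.2⟩
  exact hasMFDerivWithinAt_symm_comp h6.hasDerivWithinAt h5

/-- The point is that one time bound `ε` serves all starting points near `ξ`. This uniformity lets
continuity be propagated along a trajectory. -/
lemma eventually_continuousAt_flow (hv : IsSmoothField v) (hc : ForwardComplete v) (ξ : M) :
    ∃ ε > 0, ∀ᶠ y in 𝓝 ξ, ∀ t ∈ Ico 0 ε, ContinuousAt (flow v t) y := by
  obtain ⟨ψ, ε, hε, W, hW, h⟩ := exists_chart_flow hv hc ξ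
  have h1 : ∀ᶠ y in 𝓝 ξ, extChartAt (𝓡 n) ξ y ∈ W ∧ y ∈ (extChartAt (𝓡 n) ξ).source :=
    ((continuousAt_extChartAt ξ).eventually hW).and (extChartAt_source_mem_nhds ξ)
  refine ⟨ε, hε, ?_⟩
  filter_upwards [h1.eventually_nhds] with y hy t ht
  obtain ⟨h2, h3, -, -⟩ := (h _ hy.self_of_nhds.1).2 t ⟨by linarith [ht.1], ht.2⟩
  have he : flow v t =ᶠ[𝓝 y] fun z => (extChartAt (𝓡 n) ξ).symm (ψ (t, extChartAt (𝓡 n) ξ z)) := by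
    filter_upwards [hy] with z hz
    rw [← ((h _ hz.1).2 t ⟨by linarith [ht.1], ht.2⟩).2.2.2 ht.1, (extChartAt (𝓡 n) ξ).left_inv hz.2]
  refine ContinuousAt.congr ?_ he.symm
  have h4 : ContinuousAt (fun z => ψ (t, extChartAt (𝓡 n) ξ z)) y :=
    ContinuousAt.comp (g := ψ) h2.continuousAt
      (continuousAt_const.prodMk (continuousAt_extChartAt' hy.self_of_nhds.2))
  exact ContinuousAt.comp (g := (extChartAt (𝓡 n) ξ).symm) (continuousAt_extChartAt_symm'' h3) h4

/-- If continuity at `η` failed at some time, let `σ` be the infimum of such times. Continuity at a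
time just before `σ`, followed by the short-time flow near `flow v σ η`, gives continuity beyond
`σ`, a contradiction. -/
theorem continuous_flow (hv : IsSmoothField v) (hc : ForwardComplete v) (t : ℝ) :
    Continuous (flow v t) := by
  rw [continuous_iff_continuousAt]
  intro η
  by_contra hcon
  have hid : ∀ s ≤ 0, ContinuousAt (flow v s) η := fun s hs =>
    continuousAt_id.congr (Eventually.of_forall fun x => (flow_of_nonpos hc hs x).symm)
  set B : Set ℝ := {s | ¬ ContinuousAt (flow v s) η} with hB
  have hB0 : ∀ s ∈ B, 0 ≤ s := fun s hs => by
    by_contra h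
    exact hs (hid s (not_le.1 h).le)
  have hbdd : BddBelow B := ⟨0, hB0⟩
  have hne : B.Nonempty := ⟨t, hcon⟩
  set σ := sInf B with hσ
  have hσ0 : 0 ≤ σ := le_csInf hne hB0
  obtain ⟨ε, hε, hloc⟩ := eventually_continuousAt_flow hv hc (flow v σ η)
  obtain ⟨δ, hδ, hδ'⟩ := Metric.eventually_nhds_iff.1
    ((continuous_flow_time hc η).continuousAt.eventually hloc)
  -- A margin of `min δ ε / 2` on either side of `σ` keeps `b - s₀` below `ε`. The maximum with `0`
  -- covers `σ` near `0`, where the flow at time `0` is the identity.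
  set s₀ := max 0 (σ - min δ ε / 2) with hs₀
  have hm : 0 < min δ ε := lt_min hδ hε
  have hs₀0 : 0 ≤ s₀ := le_max_left _ _
  have hs₀σ : s₀ ≤ σ := max_le hσ0 (by linarith)
  have hs₀l : σ - min δ ε / 2 ≤ s₀ := le_max_right _ _
  have hs₀B : ContinuousAt (flow v s₀) η := by
    rcases hs₀0.eq_or_lt with h | h
    · exact hid _ h.symm.le
    · by_contra hb
      have h1 : s₀ = σ - min δ ε / 2 := by
        rcases max_choice 0 (σ - min δ ε / 2) with h' | h'
        · rw [← hs₀] at h'; linarith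
        · exact h'
      have : σ ≤ s₀ := csInf_le hbdd hb
      linarith
  obtain ⟨b, hb, hbσ⟩ := exists_lt_of_csInf_lt hne (show sInf B < σ + min δ ε / 2 by linarith)
  have hσb : σ ≤ b := csInf_le hbdd hb
  have hd : dist s₀ σ < δ := by
    rw [Real.dist_eq, abs_sub_comm, abs_of_nonneg (by linarith)]
    linarith [min_le_left δ ε]
  have h1 := hδ' hd (b - s₀) ⟨by linarith, by linarith [min_le_right δ ε]⟩
  refine hb ((ContinuousAt.comp (g := flow v (b - s₀)) h1 hs₀B).congr
    (Eventually.of_forall fun x => ?_))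
  rw [Function.comp_apply, ← flow_add hv hc hs₀0 (by linarith), add_sub_cancel]

end Flow

/-! ### Families of linear maps of constant rank, and brackets of tangent fields -/

section ConstantRank

open Topology Filter VectorField

variable {P E : Type*} [NormedAddCommGroup P] [NormedSpace ℝ P]
  [NormedAddCommGroup E] [NormedSpace ℝ E]

/-- The hypothesis says that `C` vanishes on the range of `A`, so there the perturbed operator
factors through `A'`. -/
lemma map_range_le {A A' : P →L[ℝ] E} {B : E →L[ℝ] P} {C : E →L[ℝ] E}
    (h : ∀ y ∈ A.range, (A'.comp B + C) y = A' (B y)) :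
    A.range.map ((A'.comp B + C : E →L[ℝ] E) : E →ₗ[ℝ] E) ≤ A'.range := by
  rintro _ ⟨y, hy, rfl⟩
  exact ⟨B y, (h y hy).symm⟩

lemma finrank_map_of_isUnit {S : E →L[ℝ] E} (hS : IsUnit S) (R : Submodule ℝ E) :
    Module.finrank ℝ (R.map (S : E →ₗ[ℝ] E)) = Module.finrank ℝ R := by
  obtain ⟨T, hT⟩ := hS.exists_left_inv
  refine (Submodule.equivMapOfInjective (S : E →ₗ[ℝ] E) ?_ R).finrank_eq.symm
  intro x y hxy
  have := congrArg T hxy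
  have hx : ∀ z, T (S z) = z := fun z => congrArg (fun U : E →L[ℝ] E => U z) hT
  simpa [hx] using this

variable [FiniteDimensional ℝ E]

/-- A linear map has a right inverse on its range. -/
lemma exists_comp_eq_projection (L : P →L[ℝ] E) :
    ∃ (B : E →L[ℝ] P) (p : E →L[ℝ] E), L.comp B = p ∧ ∀ y ∈ L.range, p y = y := by
  obtain ⟨s, hs⟩ := L.toLinearMap.rangeRestrict.exists_rightInverse_of_surjective
    L.toLinearMap.range_rangeRestrict
  obtain ⟨π, hπ⟩ := L.toLinearMap.range.subtype.exists_leftInverse_of_injective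
    (Submodule.ker_subtype _)
  refine ⟨LinearMap.toContinuousLinearMap (s.comp π), _, rfl, fun y hy => ?_⟩
  have h1 : π y = ⟨y, hy⟩ := LinearMap.congr_fun hπ ⟨y, hy⟩
  have h2 := congrArg Subtype.val (LinearMap.congr_fun hs ⟨y, hy⟩)
  simpa [h1] using h2

variable {X : Type*} [TopologicalSpace X]

/-- A family of linear maps can be transformed near a point into one whose range contains a fixed
subspace. -/
lemma exists_isUnit_family (A : X → P →L[ℝ] E) {q₀ : X} (hA : ContinuousAt A q₀) :
    ∃ (B : E →L[ℝ] P) (C : E →L[ℝ] E), (A q₀).comp B + C = 1 ∧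
      (∀ᶠ q in 𝓝 q₀, IsUnit ((A q).comp B + C)) ∧
      ∀ q, ∀ y ∈ (A q₀).range, ((A q).comp B + C) y = A q (B y) := by
  -- With `p` the projection `A q₀ ∘ B`, the operator `A q ∘ B + (1 - p)` is the identity at `q₀`,
  -- hence invertible nearby, and `1 - p` kills the range of `A q₀`.
  obtain ⟨B, p, hp, hy⟩ := exists_comp_eq_projection (A q₀)
  have h1 : (A q₀).comp B + (1 - p) = 1 := by rw [hp]; abel
  refine ⟨B, 1 - p, h1, ?_, fun q y h => by simp [hy y h]⟩
  have hc : ContinuousAt (fun q => (A q).comp B + (1 - p)) q₀ :=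
    (hA.clm_comp continuousAt_const).add continuousAt_const
  refine hc.eventually (Units.isOpen.mem_nhds ?_)
  change IsUnit ((A q₀).comp B + (1 - p))
  rw [h1]
  exact isUnit_one

/-- The rank of a continuous family of linear maps is lower semicontinuous. -/
lemma eventually_finrank_range_le (A : X → P →L[ℝ] E) {q₀ : X} (hA : ContinuousAt A q₀) :
    ∀ᶠ q in 𝓝 q₀, Module.finrank ℝ (A q₀).range ≤ Module.finrank ℝ (A q).range := by
  obtain ⟨B, C, -, hu, hy⟩ := exists_isUnit_family A hA
  filter_upwards [hu] with q hq
  rw [← finrank_map_of_isUnit hq]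
  exact Submodule.finrank_mono (map_range_le (hy q))

/-- A differentiable field along a map of constant rank with values in the ranges of the
derivatives lifts to a differentiable field on the source. -/
lemma exists_differentiableAt_lift {A : P → P →L[ℝ] E} {q₀ : P} (hA : DifferentiableAt ℝ A q₀)
    (hrank : ∀ᶠ q in 𝓝 q₀, Module.finrank ℝ (A q).range = Module.finrank ℝ (A q₀).range)
    {y : P → E} (hy : DifferentiableAt ℝ y q₀) (hmem : ∀ᶠ q in 𝓝 q₀, y q ∈ (A q).range) :
    ∃ a : P → P, DifferentiableAt ℝ a q₀ ∧ ∀ᶠ q in 𝓝 q₀, A q (a q) = y q := by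
  obtain ⟨B, C, h1, hu, hB⟩ := exists_isUnit_family A hA.continuousAt
  set S : P → E →L[ℝ] E := fun q => (A q).comp B + C with hS
  have hSd : DifferentiableAt ℝ S q₀ :=
    (hA.clm_comp (differentiableAt_const B)).add (differentiableAt_const C)
  have hinv : DifferentiableAt ℝ (fun q => Ring.inverse (S q)) q₀ :=
    DifferentiableAt.comp (g := Ring.inverse) q₀
      (differentiableAt_inverse (𝕜 := ℝ) hu.self_of_nhds) hSd
  -- By constancy of the rank, `S q` maps the range of `A q₀` onto that of `A q`. So the inverse
  -- image `z` of `y q` lies in the range of `A q₀`, where `S q z = A q (B z)`.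
  refine ⟨fun q => B (Ring.inverse (S q) (y q)),
    B.differentiableAt.comp q₀ (hinv.clm_apply hy), ?_⟩
  filter_upwards [hu, hrank, hmem] with q hq hr hm
  have heq : (A q₀).range.map ((S q : E →L[ℝ] E) : E →ₗ[ℝ] E) = (A q).range :=
    Submodule.eq_of_le_of_finrank_eq (map_range_le (hB q)) (by rw [finrank_map_of_isUnit hq, hr])
  rw [← heq] at hm
  obtain ⟨z, hz, hzy⟩ := hm
  have h2 : Ring.inverse (S q) (y q) = z := by
    rw [← hzy]
    exact congrArg (fun U : E →L[ℝ] E => U z) (Ring.inverse_mul_cancel _ hq)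
  rw [h2, ← hB q z hz]
  exact hzy

/-- Fields that are tangent to a map of constant rank have a tangent bracket. -/
theorem lieBracket_mem_range {f : P → E} {q₀ : P} (hf : ContDiffAt ℝ 2 f q₀)
    (hrank : ∀ᶠ q in 𝓝 q₀, Module.finrank ℝ (fderiv ℝ f q).range =
      Module.finrank ℝ (fderiv ℝ f q₀).range)
    {v w : E → E} (hv : DifferentiableAt ℝ v (f q₀)) (hw : DifferentiableAt ℝ w (f q₀))
    (hvf : ∀ᶠ q in 𝓝 q₀, v (f q) ∈ (fderiv ℝ f q).range)
    (hwf : ∀ᶠ q in 𝓝 q₀, w (f q) ∈ (fderiv ℝ f q).range) :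
    lieBracket ℝ v w (f q₀) ∈ (fderiv ℝ f q₀).range := by
  have hfd : DifferentiableAt ℝ f q₀ := hf.differentiableAt two_ne_zero
  have hA : DifferentiableAt ℝ (fderiv ℝ f) q₀ :=
    (hf.fderiv_right (m := 1) (by norm_num)).differentiableAt one_ne_zero
  obtain ⟨a, ha, hav⟩ := exists_differentiableAt_lift hA hrank
    (y := fun q => v (f q)) (hv.comp q₀ hfd) hvf
  obtain ⟨b, hb, hbw⟩ := exists_differentiableAt_lift hA hrank
    (y := fun q => w (f q)) (hw.comp q₀ hfd) hwf
  -- This is the product rule for the identity `Df(q) c(q) = y(f q)`, differentiated in the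
  -- direction `h`.
  have key : ∀ {c : P → P} {y : E → E}, DifferentiableAt ℝ c q₀ → DifferentiableAt ℝ y (f q₀) →
      (∀ᶠ q in 𝓝 q₀, fderiv ℝ f q (c q) = y (f q)) → ∀ h : P,
      fderiv ℝ y (f q₀) (fderiv ℝ f q₀ h) =
        fderiv ℝ (fderiv ℝ f) q₀ h (c q₀) + fderiv ℝ f q₀ (fderiv ℝ c q₀ h) := by
    intro c y hc hy he h
    have h1 := hA.hasFDerivAt.clm_apply hc.hasFDerivAt
    have h2 := (HasFDerivAt.comp q₀ hy.hasFDerivAt hfd.hasFDerivAt).congr_of_eventuallyEq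
      (f₁ := fun q => fderiv ℝ f q (c q)) he
    have h3 := congrArg (fun U : P →L[ℝ] E => U h) (h2.unique h1)
    simp only [ContinuousLinearMap.comp_apply, add_apply,
      ContinuousLinearMap.flip_apply] at h3
    rw [h3, add_comm]
  have h1 := key ha hv hav (b q₀)
  have h2 := key hb hw hbw (a q₀)
  rw [hbw.self_of_nhds] at h1
  rw [hav.self_of_nhds] at h2
  have hsymm : fderiv ℝ (fderiv ℝ f) q₀ (a q₀) (b q₀) = fderiv ℝ (fderiv ℝ f) q₀ (b q₀) (a q₀) :=
    (hf.isSymmSndFDerivAt (by simp)).eq _ _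
  -- The second derivatives of `f` cancel by symmetry, so the bracket is the image under `Df` of the
  -- bracket of the lifts `a` and `b`.
  refine ⟨fderiv ℝ b q₀ (a q₀) - fderiv ℝ a q₀ (b q₀), ?_⟩
  rw [lieBracket, h1, h2, hsymm]
  simp

end ConstantRank

/-! ### Endpoints of concatenated local flows -/

section Krener

open Topology Filter

/-- Restriction of a tuple to all but its last entry. -/
def initL (m : ℕ) : (Fin (m + 1) → ℝ) →L[ℝ] (Fin m → ℝ) :=
  ContinuousLinearMap.pi fun l => ContinuousLinearMap.proj l.castSucc

/-- Appending an entry to a tuple. -/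
def snocL (m : ℕ) : (Fin m → ℝ) × ℝ →L[ℝ] (Fin (m + 1) → ℝ) :=
  ContinuousLinearMap.pi fun l => Fin.lastCases (ContinuousLinearMap.snd ℝ _ _)
    (fun l => (ContinuousLinearMap.proj l).comp (ContinuousLinearMap.fst ℝ _ _)) l

@[simp] lemma initL_apply {m : ℕ} (s : Fin (m + 1) → ℝ) (l : Fin m) :
    initL m s l = s l.castSucc := rfl

@[simp] lemma snocL_last {m : ℕ} (z : (Fin m → ℝ) × ℝ) : snocL m z (Fin.last m) = z.2 := by
  simp [snocL]

@[simp] lemma initL_snocL {m : ℕ} (z : (Fin m → ℝ) × ℝ) : initL m (snocL m z) = z.1 := by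
  ext l
  simp [snocL]

lemma snocL_initL {m : ℕ} (s : Fin (m + 1) → ℝ) : snocL m (initL m s, s (Fin.last m)) = s := by
  ext l
  refine Fin.lastCases (by simp) (fun l => ?_) l
  have := congrFun (initL_snocL (initL m s, s (Fin.last m))) l
  simpa using this

variable {S E : Type*}

/-- The endpoint of a concatenation of local flows. -/
def flowChain (ψ : S → ℝ × E → E) (x₀ : E) (r : ℕ → S) : (m : ℕ) → (Fin m → ℝ) → E
  | 0, _ => x₀
  | m + 1, s => ψ (r m) (s (Fin.last m), flowChain ψ x₀ r m (initL m s))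

/-- Tuples of positive times for which the concatenation of local flows makes sense. -/
def flowChainDomain (ψ : S → ℝ × E → E) (x₀ : E) (ε : ℝ) (W : Set E) (r : ℕ → S) :
    (m : ℕ) → Set (Fin m → ℝ)
  | 0 => univ
  | m + 1 => {s | initL m s ∈ flowChainDomain ψ x₀ ε W r m ∧
      flowChain ψ x₀ r m (initL m s) ∈ W ∧ s (Fin.last m) ∈ Ioo 0 ε}

variable {ψ : S → ℝ × E → E} {x₀ : E} {ε : ℝ} {W : Set E}

lemma flowChain_congr {r r' : ℕ → S} {m : ℕ} (h : ∀ l < m, r l = r' l) :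
    flowChain ψ x₀ r m = flowChain ψ x₀ r' m := by
  induction m with
  | zero => rfl
  | succ m ih =>
    ext s
    simp only [flowChain]
    rw [ih fun l hl => h l (by omega), h m (by omega)]

lemma flowChainDomain_congr {r r' : ℕ → S} {m : ℕ} (h : ∀ l < m, r l = r' l) :
    flowChainDomain ψ x₀ ε W r m = flowChainDomain ψ x₀ ε W r' m := by
  induction m with
  | zero => rfl
  | succ m ih =>
    simp only [flowChainDomain]
    rw [ih fun l hl => h l (by omega), flowChain_congr (r' := r') fun l hl => h l (by omega)]

lemma pos_of_mem_flowChainDomain {r : ℕ → S} {m : ℕ} {s : Fin m → ℝ}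
    (hs : s ∈ flowChainDomain ψ x₀ ε W r m) (l : Fin m) : 0 < s l := by
  induction m with
  | zero => exact l.elim0
  | succ m ih => exact Fin.lastCases hs.2.2.1 (fun l => ih hs.1 l) l

variable [NormedAddCommGroup E] [NormedSpace ℝ E] {v : S → E → E}

/-- `ψ` is a flow of `v` that starts in `W` and lives up to the time `ε`. -/
structure IsLocalFlow (ψ : ℝ × E → E) (v : E → E) (ε : ℝ) (W : Set E) : Prop where
  zero : ∀ x ∈ W, ψ (0, x) = x
  contDiffAt : ∀ x ∈ W, ∀ t ∈ Ioo (-ε) ε, ContDiffAt ℝ 2 ψ (t, x)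
  hasDerivAt : ∀ x ∈ W, ∀ t ∈ Ioo (-ε) ε, HasDerivAt (fun s => ψ (s, x)) (v (ψ (t, x))) t

lemma contDiffAt_flowChain_succ (hψ : ∀ l, IsLocalFlow (ψ l) (v l) ε W) {r : ℕ → S} {m : ℕ}
    {s : Fin (m + 1) → ℝ} (h : ContDiffAt ℝ 2 (flowChain ψ x₀ r m) (initL m s))
    (hW : flowChain ψ x₀ r m (initL m s) ∈ W) (hs : s (Fin.last m) ∈ Ioo (-ε) ε) :
    ContDiffAt ℝ 2 (flowChain ψ x₀ r (m + 1)) s := by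
  have h1 : ContDiffAt ℝ 2 (fun s => flowChain ψ x₀ r m (initL m s)) s :=
    ContDiffAt.comp (g := flowChain ψ x₀ r m) s h (initL m).contDiff.contDiffAt
  have h2 : ContDiffAt ℝ 2 (fun s : Fin (m + 1) → ℝ => s (Fin.last m)) s := by fun_prop
  exact ContDiffAt.comp (g := ψ (r m)) s ((hψ (r m)).contDiffAt _ hW _ hs) (h2.prodMk h1)

lemma contDiffAt_flowChain (hε : 0 < ε) (hψ : ∀ l, IsLocalFlow (ψ l) (v l) ε W) {r : ℕ → S} {m : ℕ}
    {s : Fin m → ℝ} (hs : s ∈ flowChainDomain ψ x₀ ε W r m) :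
    ContDiffAt ℝ 2 (flowChain ψ x₀ r m) s := by
  induction m with
  | zero => exact contDiffAt_const
  | succ m ih =>
    exact contDiffAt_flowChain_succ hψ (ih hs.1) hs.2.1 ⟨by linarith [hs.2.2.1], hs.2.2.2⟩

lemma isOpen_flowChainDomain (hε : 0 < ε) (hW : IsOpen W)
    (hψ : ∀ l, IsLocalFlow (ψ l) (v l) ε W) (r : ℕ → S) (m : ℕ) :
    IsOpen (flowChainDomain ψ x₀ ε W r m) := by
  induction m with
  | zero => exact isOpen_univ
  | succ m ih =>
    have h1 : IsOpen (flowChainDomain ψ x₀ ε W r m ∩ flowChain ψ x₀ r m ⁻¹' W) :=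
      ContinuousOn.isOpen_inter_preimage (fun s hs =>
        (contDiffAt_flowChain hε hψ hs).continuousAt.continuousWithinAt) ih hW
    have h2 := (h1.preimage (initL m).continuous).inter
      ((isOpen_Ioo (a := 0) (b := ε)).preimage (continuous_apply (Fin.last m)))
    convert h2 using 1
    ext s
    simp [flowChainDomain, and_assoc]

/-- Varying the last time alone moves the endpoint with velocity `v (r m)`. Last times in `(-ε, ε)`
are allowed because the result is needed at time `0` of a newly appended regime. -/
lemma fderiv_flowChain_last (hψ : ∀ l, IsLocalFlow (ψ l) (v l) ε W) {r : ℕ → S} {m : ℕ}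
    {s : Fin (m + 1) → ℝ} (h : ContDiffAt ℝ 2 (flowChain ψ x₀ r m) (initL m s))
    (hW : flowChain ψ x₀ r m (initL m s) ∈ W) (hs : s (Fin.last m) ∈ Ioo (-ε) ε) :
    v (r m) (flowChain ψ x₀ r (m + 1) s) ∈ (fderiv ℝ (flowChain ψ x₀ r (m + 1)) s).range := by
  have h1 := ((contDiffAt_flowChain_succ hψ h hW hs).differentiableAt two_ne_zero).hasFDerivAt
  have h2 : HasDerivAt (fun t : ℝ => snocL m (initL m s, t)) (snocL m (0, 1)) (s (Fin.last m)) :=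
    HasFDerivAt.comp_hasDerivAt (l := snocL m) _ (snocL m).hasFDerivAt
      ((hasDerivAt_const _ _).prodMk (hasDerivAt_id _))
  have h3 := HasFDerivAt.comp_hasDerivAt_of_eq (l := flowChain ψ x₀ r (m + 1)) _ h1 h2
    (snocL_initL s).symm
  have h4 := (hψ (r m)).hasDerivAt _ hW _ hs
  refine ⟨_, h3.unique (h4.congr_of_eventuallyEq (Eventually.of_forall fun t => ?_))⟩
  simp [flowChain]

/-- A flow for time `0` is the identity, so the shorter chain is the restriction of the longer one
to the slice of last time `0`, and its derivative factors accordingly. -/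
lemma range_fderiv_flowChain_le (hε : 0 < ε) (hW : IsOpen W)
    (hψ : ∀ l, IsLocalFlow (ψ l) (v l) ε W) {r : ℕ → S} {m : ℕ}
    {q : Fin m → ℝ} (h : ContDiffAt ℝ 2 (flowChain ψ x₀ r m) q)
    (hq : flowChain ψ x₀ r m q ∈ W) :
    (fderiv ℝ (flowChain ψ x₀ r m) q).range ≤
      (fderiv ℝ (flowChain ψ x₀ r (m + 1)) (snocL m (q, 0))).range := by
  have h1 : DifferentiableAt ℝ (flowChain ψ x₀ r (m + 1)) (snocL m (q, 0)) :=
    (contDiffAt_flowChain_succ hψ (by simpa using h) (by simpa using hq)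
      (by simpa using hε)).differentiableAt two_ne_zero
  have h2 : HasFDerivAt (fun q : Fin m → ℝ => snocL m (q, 0))
      ((snocL m).comp (ContinuousLinearMap.inl ℝ _ _)) q :=
    ((snocL m).comp (ContinuousLinearMap.inl ℝ _ _)).hasFDerivAt
  have h3 := HasFDerivAt.comp (g := flowChain ψ x₀ r (m + 1)) q h1.hasFDerivAt h2
  have h4 : (flowChain ψ x₀ r m) =ᶠ[𝓝 q] (flowChain ψ x₀ r (m + 1)) ∘ fun q => snocL m (q, 0) := by
    filter_upwards [h.continuousAt.eventually (hW.mem_nhds hq)] with p hp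
    simp [flowChain, (hψ (r m)).zero _ hp]
  rw [(h3.congr_of_eventuallyEq h4).fderiv]
  rintro _ ⟨y, rfl⟩
  exact ⟨_, rfl⟩

/-- If the fields do not annihilate a common quotient along maps of constant rank, then
concatenated local flows are submersive somewhere. -/
theorem exists_flowChain_submersion [FiniteDimensional ℝ E] {adm : S → S → Prop}
    (hadm : ∀ i j, i ≠ j → adm i j) (hε : 0 < ε) (hW : IsOpen W) (hx₀ : x₀ ∈ W)
    (hψ : ∀ l, IsLocalFlow (ψ l) (v l) ε W)
    (hspan : ∀ (m : ℕ) (f : (Fin m → ℝ) → E) (s : Fin m → ℝ),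
      (∀ᶠ q in 𝓝 s, ContDiffAt ℝ 2 f q ∧ f q ∈ W ∧
        Module.finrank ℝ (fderiv ℝ f q).range = Module.finrank ℝ (fderiv ℝ f s).range ∧
        ∀ l, v l (f q) ∈ (fderiv ℝ f q).range) → (fderiv ℝ f s).range = ⊤) (i : S) :
    ∃ (r : ℕ → S) (m : ℕ), r 0 = i ∧ (∀ l < m, adm (r l) (r (l + 1))) ∧
      ∃ s ∈ flowChainDomain ψ x₀ ε W r (m + 1), flowChain ψ x₀ r (m + 1) s ∈ W ∧
        (fderiv ℝ (flowChain ψ x₀ r (m + 1)) s).range = ⊤ := by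
  -- The ranks attained by admissible chains with positive times and endpoint in `W`; a maximal one
  -- is selected.
  let T : Set ℕ := {ρ | ∃ (r : ℕ → S) (m : ℕ), r 0 = i ∧ (∀ l < m, adm (r l) (r (l + 1))) ∧
      ∃ s ∈ flowChainDomain ψ x₀ ε W r (m + 1), flowChain ψ x₀ r (m + 1) s ∈ W ∧
        Module.finrank ℝ (fderiv ℝ (flowChain ψ x₀ r (m + 1)) s).range = ρ}
  have hbdd : BddAbove T := by
    refine ⟨Module.finrank ℝ E, ?_⟩
    rintro _ ⟨r, m, -, -, s, -, -, rfl⟩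
    exact Submodule.finrank_le _
  -- small positive last times are allowed
  have hext : ∀ (r : ℕ → S) (m : ℕ) (q : Fin m → ℝ), q ∈ flowChainDomain ψ x₀ ε W r m →
      flowChain ψ x₀ r m q ∈ W → ∀ᶠ t in 𝓝[>] (0 : ℝ),
        snocL m (q, t) ∈ flowChainDomain ψ x₀ ε W r (m + 1) ∧
        flowChain ψ x₀ r (m + 1) (snocL m (q, t)) ∈ W ∧
        Module.finrank ℝ (fderiv ℝ (flowChain ψ x₀ r (m + 1)) (snocL m (q, 0))).range ≤
          Module.finrank ℝ (fderiv ℝ (flowChain ψ x₀ r (m + 1)) (snocL m (q, t))).range := by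
    intro r m q hq hqW
    have hc : ContDiffAt ℝ 2 (flowChain ψ x₀ r (m + 1)) (snocL m (q, 0)) :=
      contDiffAt_flowChain_succ hψ (by simpa using contDiffAt_flowChain hε hψ hq)
        (by simpa using hqW) (by simpa using hε)
    have ht : Tendsto (fun t : ℝ => snocL m (q, t)) (𝓝[>] 0) (𝓝 (snocL m (q, 0))) :=
      ((by fun_prop : Continuous fun t : ℝ => snocL m (q, t)).tendsto 0).mono_left
        nhdsWithin_le_nhds
    have h0 : flowChain ψ x₀ r (m + 1) (snocL m (q, 0)) ∈ W := by
      simpa [flowChain, (hψ (r m)).zero _ hqW] using hqW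
    filter_upwards [Ioo_mem_nhdsGT hε, ht.eventually (hc.continuousAt.eventually (hW.mem_nhds h0)),
      ht.eventually (eventually_finrank_range_le _
        (hc.fderiv_right (m := 1) (by norm_num)).continuousAt)] with t ht1 ht2 ht3
    exact ⟨⟨by simpa using hq, by simpa using hqW, by simpa using ht1⟩, ht2, ht3⟩
  have hne : T.Nonempty := by
    obtain ⟨t, ht⟩ := (hext (fun _ => i) 0 ![] trivial hx₀).exists
    exact ⟨_, fun _ => i, 0, rfl, by simp, _, ht.1, ht.2.1, rfl⟩
  obtain ⟨r, m, hr0, hadm', s, hs, hsW, hrank⟩ := Nat.sSup_mem hne hbdd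
  refine ⟨r, m, hr0, hadm', s, hs, hsW, hspan _ _ s ?_⟩
  have hc := contDiffAt_flowChain hε hψ hs
  filter_upwards [(isOpen_flowChainDomain hε hW hψ r (m + 1)).mem_nhds hs,
    hc.continuousAt.eventually (hW.mem_nhds hsW),
    eventually_finrank_range_le _ (hc.fderiv_right (m := 1) (by norm_num)).continuousAt]
    with q hq hqW hqr
  -- Maximality bounds the rank from above and lower semicontinuity from below, so it is constant
  -- near `s`.
  have hmax : Module.finrank ℝ (fderiv ℝ (flowChain ψ x₀ r (m + 1)) q).range = sSup T :=
    le_antisymm (le_csSup hbdd ⟨r, m, hr0, hadm', q, hq, hqW, rfl⟩) (hrank ▸ hqr)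
  have hcq := contDiffAt_flowChain hε hψ hq
  refine ⟨hcq, hqW, hmax.trans hrank.symm, fun l => ?_⟩
  -- Only jumps between distinct regimes are known to be admissible, so the regime that is already
  -- last is treated by varying its own time.
  by_cases hl : r m = l
  · rw [← hl]
    exact fderiv_flowChain_last hψ (contDiffAt_flowChain hε hψ hq.1) hq.2.1
      ⟨by linarith [hq.2.2.1], hq.2.2.2⟩
  -- a new regime
  let r' := Function.update r (m + 1) l
  have hr' : ∀ j < m + 1, r' j = r j := fun j hj => Function.update_of_ne hj.ne _ _
  have hr'm : r' (m + 1) = l := Function.update_self ..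
  have hF : flowChain ψ x₀ r' (m + 1) = flowChain ψ x₀ r (m + 1) := flowChain_congr hr'
  have hD : flowChainDomain ψ x₀ ε W r' (m + 1) = flowChainDomain ψ x₀ ε W r (m + 1) :=
    flowChainDomain_congr hr'
  have hadm'' : ∀ j < m + 1, adm (r' j) (r' (j + 1)) := by
    intro j hj
    rcases (Nat.lt_succ_iff.1 hj).lt_or_eq with h | h
    · rw [hr' j hj, hr' (j + 1) (by omega)]
      exact hadm' j h
    · rw [hr' j hj, h, hr'm]
      exact hadm _ _ hl
  obtain ⟨t, ht1, ht2, ht3⟩ := (hext r' (m + 1) q (hD ▸ hq) (hF ▸ hqW)).exists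
  have hle := range_fderiv_flowChain_le hε hW hψ (hF ▸ hcq) (hF ▸ hqW)
  rw [hF] at hle
  -- The last time `0` is not in the domain. The rank there is at most the rank at a small positive
  -- `t`, hence at most the maximum, so the appended regime adds nothing to the range.
  have heq := Submodule.eq_of_le_of_finrank_le hle (by
    rw [hmax]
    exact ht3.trans (le_csSup hbdd ⟨r', m + 1, (hr' 0 (by omega)).trans hr0, hadm'', _, ht1, ht2,
      rfl⟩))
  rw [heq]
  have hval : flowChain ψ x₀ r' (m + 1 + 1) (snocL (m + 1) (q, 0)) = flowChain ψ x₀ r (m + 1) q :=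
    calc _ = ψ (r' (m + 1)) (snocL (m + 1) (q, 0) (Fin.last _),
          flowChain ψ x₀ r' (m + 1) (initL (m + 1) (snocL (m + 1) (q, 0)))) := rfl
      _ = _ := by rw [snocL_last, initL_snocL, hF, hr'm, (hψ l).zero _ hqW]
  have := fderiv_flowChain_last hψ (x₀ := x₀) (r := r') (s := snocL (m + 1) (q, 0))
    (by rw [initL_snocL, hF]; exact hcq) (by rw [initL_snocL, hF]; exact hqW) (by simpa using hε)
  rwa [hr'm, hval] at this

end Krener

/-! ### Consequences of Condition B -/

section ConditionB

open Topology Filter VectorField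

variable {n : ℕ} {M : Type*} [TopologicalSpace M] [ChartedSpace (EuclideanSpace ℝ (Fin n)) M]
  [IsManifold (𝓡 n) ∞ M]

lemma IsSmoothField.add {v w : (x : M) → TangentSpace (𝓡 n) x} (hv : IsSmoothField v)
    (hw : IsSmoothField w) : IsSmoothField (v + w) :=
  ContMDiff.add_section hv hw

lemma IsSmoothField.const_smul {v : (x : M) → TangentSpace (𝓡 n) x} (hv : IsSmoothField v)
    (c : ℝ) : IsSmoothField (c • v) :=
  ContMDiff.const_smul_section hv

lemma isSmoothField_zero : IsSmoothField (0 : (x : M) → TangentSpace (𝓡 n) x) :=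
  Bundle.contMDiff_zeroSection ℝ _

/-- The smooth fields whose chart representation is tangent to a map near a point. -/
def tangentFields {m : ℕ} (ξ : M) (f : (Fin m → ℝ) → EuclideanSpace ℝ (Fin n)) (s : Fin m → ℝ) :
    Submodule ℝ ((x : M) → TangentSpace (𝓡 n) x) where
  carrier := {v | IsSmoothField v ∧ ∀ᶠ q in 𝓝 s, chartField ξ v (f q) ∈ (fderiv ℝ f q).range}
  add_mem' := fun ⟨hv, hv'⟩ ⟨hw, hw'⟩ => ⟨hv.add hw, by
    filter_upwards [hv', hw'] with q h1 h2
    rw [chartField_add]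
    exact Submodule.add_mem _ h1 h2⟩
  zero_mem' := ⟨isSmoothField_zero, by
    rw [chartField_zero]
    exact Eventually.of_forall fun q => Submodule.zero_mem _⟩
  smul_mem' := fun c v ⟨hv, hv'⟩ => ⟨hv.const_smul c, by
    filter_upwards [hv'] with q h
    rw [chartField_smul]
    exact Submodule.smul_mem _ c h⟩

/-- Tangency on a neighbourhood, not just at `s`, is what makes this work: at each nearby `q` the
bracket theorem again uses tangency and constant rank around `q`. -/
lemma isLieSubalgebra_tangentFields {m : ℕ} {ξ : M} {f : (Fin m → ℝ) → EuclideanSpace ℝ (Fin n)}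
    {s : Fin m → ℝ}
    (hf : ∀ᶠ q in 𝓝 s, ContDiffAt ℝ 2 f q ∧ f q ∈ (extChartAt (𝓡 n) ξ).target ∧
      Module.finrank ℝ (fderiv ℝ f q).range = Module.finrank ℝ (fderiv ℝ f s).range) :
    IsLieSubalgebra (tangentFields ξ f s) := by
  refine ⟨fun v hv => hv.1, fun v ⟨hv, hv'⟩ w ⟨hw, hw'⟩ => ⟨hv.mlieBracket hw, ?_⟩⟩
  filter_upwards [hf.eventually_nhds, hv'.eventually_nhds, hw'.eventually_nhds] with q h1 h2 h3
  obtain ⟨h4, h5, h6⟩ := h1.self_of_nhds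
  rw [chartField_mlieBracket hv hw h5]
  have hd : ∀ {v : (x : M) → TangentSpace (𝓡 n) x}, IsSmoothField v →
      DifferentiableAt ℝ (chartField ξ v) (f q) := fun hv =>
    ((contDiffOn_chartField hv ξ).contDiffAt
      ((isOpen_extChartAt_target ξ).mem_nhds h5)).differentiableAt (by simp)
  refine lieBracket_mem_range h4 ?_ (hd hv) (hd hw) h2 h3
  filter_upwards [h1] with p hp
  rw [hp.2.2, h6]

/-- Condition B holds near `ξ`: the fields that are tangent to a map of constant rank near `ξ`
include all `u i` only if the map is a submersion. -/
lemma ConditionB.exists_nhds {S : Type*} {u : S → (x : M) → TangentSpace (𝓡 n) x} {ξ : M}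
    (hsmooth : ∀ i, IsSmoothField (u i)) (hB : ConditionB u ξ) :
    ∃ W ∈ 𝓝 (extChartAt (𝓡 n) ξ ξ), W ⊆ (extChartAt (𝓡 n) ξ).target ∧
    ∀ (m : ℕ) (f : (Fin m → ℝ) → EuclideanSpace ℝ (Fin n)) (s : Fin m → ℝ),
      (∀ᶠ q in 𝓝 s, ContDiffAt ℝ 2 f q ∧ f q ∈ W ∧
        Module.finrank ℝ (fderiv ℝ f q).range = Module.finrank ℝ (fderiv ℝ f s).range ∧
        ∀ l, chartField ξ (u l) (f q) ∈ (fderiv ℝ f q).range) → (fderiv ℝ f s).range = ⊤ := by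
  set x₀ := extChartAt (𝓡 n) ξ ξ with hx₀
  have hx₀t : x₀ ∈ (extChartAt (𝓡 n) ξ).target := mem_extChartAt_target ξ
  -- `η` equals `ξ` only propositionally. Condition B is transported to `η` so that its tangent
  -- space is the one where the derivative of the inverse chart takes values.
  set η := (extChartAt (𝓡 n) ξ).symm x₀ with hη
  have hB' : ConditionB u η := by rw [hη, hx₀, extChartAt_to_inv]; exact hB
  have hsurj : ∀ y : EuclideanSpace ℝ (Fin n),
      ∃ v ∈ generatedLieAlgebra u, chartField ξ v x₀ = y := by
    intro y
    have hfr : Module.finrank ℝ (TangentSpace (𝓡 n) η) = n := finrank_euclideanSpace_fin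
    have : FiniteDimensional ℝ (TangentSpace (𝓡 n) η) :=
      inferInstanceAs (FiniteDimensional ℝ (EuclideanSpace ℝ (Fin n)))
    have htop := Submodule.eq_top_of_finrank_eq (hB'.trans hfr.symm)
    have hmem : mfderiv 𝓘(ℝ, EuclideanSpace ℝ (Fin n)) (𝓡 n) (extChartAt (𝓡 n) ξ).symm x₀ y ∈
        (generatedLieAlgebra u).map
          (LinearMap.proj η : ((x : M) → TangentSpace (𝓡 n) x) →ₗ[ℝ] TangentSpace (𝓡 n) η) := by
      rw [htop]; trivial
    obtain ⟨v, hv, hvy⟩ := hmem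
    exact ⟨v, hv, (congrArg _ hvy).trans
      ((isInvertible_mfderiv_extChartAt_symm' hx₀t).inverse_apply_self y)⟩
  choose w hw hwx using hsurj
  let b := EuclideanSpace.basisFun (Fin n) ℝ
  -- All smooth fields form a Lie subalgebra containing the `u i`, so minimality applies.
  have hwsmooth : ∀ y, IsSmoothField (w y) := by
    intro y
    have hmem : IsLieSubalgebra ({ carrier := {v | IsSmoothField v}
                                   add_mem' := IsSmoothField.add
                                   zero_mem' := isSmoothField_zero
                                   smul_mem' := fun c v hv => hv.const_smul c } :
        Submodule ℝ ((x : M) → TangentSpace (𝓡 n) x)) :=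
      ⟨fun v hv => hv, fun v hv w hw => IsSmoothField.mlieBracket hv hw⟩
    exact (Submodule.mem_sInf.1 (hw y)) _ ⟨hmem, hsmooth⟩
  -- Finitely many members of the Lie algebra form a basis at `x₀`, and linear independence is an
  -- open condition. This one neighbourhood serves all maps `f`.
  have hli : ∀ᶠ x in 𝓝 x₀, LinearIndependent ℝ fun j => chartField ξ (w (b j)) x := by
    have hc : ContinuousAt (fun x j => chartField ξ (w (b j)) x) x₀ :=
      continuousAt_pi.2 fun j => (contDiffOn_chartField (hwsmooth _) ξ).continuousOn.continuousAt
        ((isOpen_extChartAt_target ξ).mem_nhds hx₀t)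
    refine hc.eventually (isOpen_setOfPred_linearIndependent.mem_nhds ?_)
    simp only [hwx]
    have := b.toBasis.linearIndependent
    rwa [b.coe_toBasis] at this
  refine ⟨_, Filter.inter_mem hli ((isOpen_extChartAt_target ξ).mem_nhds hx₀t), inter_subset_right,
    fun m f s hf => ?_⟩
  have hL : IsLieSubalgebra (tangentFields ξ f s) := isLieSubalgebra_tangentFields (by
    filter_upwards [hf] with q hq
    exact ⟨hq.1, hq.2.1.2, hq.2.2.1⟩)
  have hle : generatedLieAlgebra u ≤ tangentFields ξ f s :=
    sInf_le ⟨hL, fun l => ⟨hsmooth l, by filter_upwards [hf] with q hq using hq.2.2.2 l⟩⟩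
  have hspan := hf.self_of_nhds.2.1.1.span_eq_top_of_card_eq_finrank' (by simp)
  rw [eq_top_iff, ← hspan, Submodule.span_le]
  rintro _ ⟨j, rfl⟩
  exact (hle (hw (b j))).2.self_of_nhds

variable [T2Space M]

/-- Under Condition B, concatenated flows are submersive in the chart at `ξ` for suitable regimes
and positive times. Each concatenation may end with a further flow. -/
theorem exists_submersive_regimes {S : Type*} [Finite S]
    {u : S → (x : M) → TangentSpace (𝓡 n) x}
    (hsmooth : ∀ i, IsSmoothField (u i)) (hcomplete : ∀ i, ForwardComplete (u i)) {ξ : M}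
    (hB : ConditionB u ξ) {adm : S → S → Prop} (hadm : ∀ i j, i ≠ j → adm i j) (i : S) :
    ∃ (ψ : S → ℝ × EuclideanSpace ℝ (Fin n) → EuclideanSpace ℝ (Fin n)) (ε : ℝ)
      (W : Set (EuclideanSpace ℝ (Fin n))),
      0 < ε ∧ IsOpen W ∧ W ⊆ (extChartAt (𝓡 n) ξ).target ∧
      (∀ l, IsLocalFlow (ψ l) (chartField ξ (u l)) ε W) ∧
      (∀ l, ∀ x ∈ W, ∀ t ∈ Ico 0 ε, flow (u l) t ((extChartAt (𝓡 n) ξ).symm x) =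
          (extChartAt (𝓡 n) ξ).symm (ψ l (t, x))) ∧
      ∃ (r : ℕ → S) (m : ℕ), r 0 = i ∧ (∀ l < m, adm (r l) (r (l + 1))) ∧
      ∃ s ∈ flowChainDomain ψ (extChartAt (𝓡 n) ξ ξ) ε W r (m + 1),
        flowChain ψ (extChartAt (𝓡 n) ξ ξ) r (m + 1) s ∈ W ∧
        (fderiv ℝ (flowChain ψ (extChartAt (𝓡 n) ξ ξ) r (m + 1)) s).range = ⊤ := by
  obtain ⟨W₀, hW₀, hW₀t, hspan⟩ := hB.exists_nhds hsmooth
  choose ψ δ hδ V hV h using fun l => exists_chart_flow (hsmooth l) (hcomplete l) ξ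
  -- Finiteness of `S` yields a common time bound, and below a common neighbourhood.
  have hev : ∀ᶠ ε in 𝓝[>] (0 : ℝ), ∀ l, ε < δ l :=
    eventually_all.2 fun l => mem_nhdsWithin_of_mem_nhds (Iio_mem_nhds (hδ l))
  obtain ⟨ε, hεδ, hε⟩ := (hev.and self_mem_nhdsWithin).exists
  replace hε : 0 < ε := hε
  set W := interior (W₀ ∩ ⋂ l, V l) with hWdef
  have hsub : W ⊆ W₀ ∩ ⋂ l, V l := interior_subset
  have hx₀ : extChartAt (𝓡 n) ξ ξ ∈ W :=
    mem_interior_iff_mem_nhds.2 (Filter.inter_mem hW₀ (iInter_mem.2 hV))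
  have hmem : ∀ l, ∀ x ∈ W, x ∈ V l := fun l x hx => mem_iInter.1 (hsub hx).2 l
  have hψ : ∀ l, IsLocalFlow (ψ l) (chartField ξ (u l)) ε W := fun l =>
    ⟨fun x hx => (h l x (hmem l x hx)).1,
      fun x hx t ht => ((h l x (hmem l x hx)).2 t
        ⟨by linarith [hεδ l, ht.1], ht.2.trans (hεδ l)⟩).1,
      fun x hx t ht => ((h l x (hmem l x hx)).2 t
        ⟨by linarith [hεδ l, ht.1], ht.2.trans (hεδ l)⟩).2.2.1⟩
  refine ⟨ψ, ε, W, hε, isOpen_interior, fun x hx => hW₀t (hsub hx).1, hψ, fun l x hx t ht =>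
    ((h l x (hmem l x hx)).2 t
        ⟨by linarith [hεδ l, ht.1], ht.2.trans (hεδ l)⟩).2.2.2 ht.1, ?_⟩
  refine exists_flowChain_submersion hadm hε isOpen_interior hx₀ hψ (fun m f s hf => ?_) i
  refine hspan m f s ?_
  filter_upwards [hf] with q hq
  exact ⟨hq.1, (hsub hq.2.1).1, hq.2.2⟩

end ConditionB

/-! ### Null sets and submersions -/

section NullSets

open Topology Filter

/-- Preimages of null sets under a local diffeomorphism are null. -/
lemma exists_nhds_preimage_null_of_fderiv_eq_id {P : Type*} [NormedAddCommGroup P] [NormedSpace ℝ P]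
    [FiniteDimensional ℝ P] [MeasurableSpace P] [BorelSpace P] (μ : Measure P) [μ.IsAddHaarMeasure]
    {h : P → P} {s : P} (hc : ContDiffAt ℝ 1 h s)
    (hd : HasFDerivAt h (ContinuousLinearMap.id ℝ P) s) :
    ∃ U ∈ 𝓝 s, ∀ Z : Set P, μ Z = 0 → μ (U ∩ h ⁻¹' Z) = 0 := by
  have hd' : HasFDerivAt h ((ContinuousLinearEquiv.refl ℝ P : P ≃L[ℝ] P) : P →L[ℝ] P) s := hd
  set H := hc.toOpenPartialHomeomorph h hd' one_ne_zero with hH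
  have hHc : (H : P → P) = h := hc.toOpenPartialHomeomorph_coe hd' one_ne_zero
  have hs : s ∈ H.source := hc.mem_toOpenPartialHomeomorph_source hd' one_ne_zero
  have hsymm : ContDiffAt ℝ 1 H.symm (h s) := hc.to_localInverse hd' one_ne_zero
  have hev : ∀ᶠ y in 𝓝 (h s), DifferentiableAt ℝ H.symm y :=
    (hsymm.eventually (by simp)).mono fun y hy => hy.differentiableAt one_ne_zero
  refine ⟨H.source ∩ h ⁻¹' {y | DifferentiableAt ℝ H.symm y}, Filter.inter_mem
    (H.open_source.mem_nhds hs) (hc.continuousAt.eventually hev), fun Z hZ => ?_⟩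
  -- The preimage lies in the image of the null set under the differentiable local inverse.
  refine measure_mono_null (t := H.symm '' (Z ∩ {y | DifferentiableAt ℝ H.symm y})) ?_ ?_
  · rintro q ⟨⟨hq, hq'⟩, hqZ⟩
    refine ⟨h q, ⟨hqZ, hq'⟩, ?_⟩
    rw [← hHc]
    exact H.left_inv hq
  · exact addHaar_image_eq_zero_of_differentiableOn_of_addHaar_eq_zero μ
      (fun y hy => hy.2.differentiableWithinAt) (measure_mono_null inter_subset_left hZ)

/-- Preimages of null sets under a submersion are null. -/
theorem exists_nhds_preimage_null {P E : Type*} [NormedAddCommGroup P] [NormedSpace ℝ P]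
    [FiniteDimensional ℝ P] [MeasurableSpace P] [BorelSpace P] (μ : Measure P) [μ.IsAddHaarMeasure]
    [NormedAddCommGroup E] [NormedSpace ℝ E] [FiniteDimensional ℝ E] [MeasurableSpace E]
    [BorelSpace E] (ν : Measure E) [ν.IsAddHaarMeasure] {f : P → E} {s : P}
    (hf : ContDiffAt ℝ 1 f s) (hsurj : (fderiv ℝ f s).range = ⊤) :
    ∃ U ∈ 𝓝 s, ∀ N : Set E, ν N = 0 → μ (U ∩ f ⁻¹' N) = 0 := by
  set L := fderiv ℝ f s with hL
  obtain ⟨B, p, hp, hBp⟩ := exists_comp_eq_projection L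
  have hLB : ∀ y, L (B y) = y := fun y => by
    have := hBp y (by rw [hsurj]; trivial)
    rw [← hp] at this
    exact this
  -- Chosen so that `L ∘ h` is `f` up to a constant while `h` has derivative `id` at `s`. Thus `f`
  -- is a surjective linear map and a translation after a local diffeomorphism, each of which pulls
  -- null sets back to null sets.
  let h : P → P := fun q => q + B (f q - f s - L (q - s))
  have hLh : ∀ q, f q = L (h q) + (f s - L s) := fun q => by
    simp only [h, map_add, hLB, map_sub]
    abel
  have hhc : ContDiffAt ℝ 1 h s := contDiffAt_id.add (B.contDiff.contDiffAt.comp s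
    ((hf.sub contDiffAt_const).sub (L.contDiff.contDiffAt.comp s
      (contDiffAt_id.sub contDiffAt_const))))
  have hhd : HasFDerivAt h (ContinuousLinearMap.id ℝ P) s := by
    have h1 : HasFDerivAt f L s := (hf.differentiableAt one_ne_zero).hasFDerivAt
    have h2 : HasFDerivAt (fun q => L (q - s)) L s := L.hasFDerivAt.comp s
      ((hasFDerivAt_id s).sub_const s)
    have h3 := (hasFDerivAt_id (𝕜 := ℝ) s).add
      (B.hasFDerivAt.comp s ((h1.sub_const (f s)).sub h2))
    refine h3.congr_fderiv ?_
    simp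
  obtain ⟨U, hU, hnull⟩ := exists_nhds_preimage_null_of_fderiv_eq_id μ hhc hhd
  refine ⟨U, hU, fun N hN => ?_⟩
  have hN' : ν ((fun y => y + (f s - L s)) ⁻¹' N) = 0 := by
    rw [measure_preimage_add_right, hN]
  have hq : Measure.QuasiMeasurePreserving L μ ν := by
    obtain ⟨c, -, hc⟩ := L.toLinearMap.exists_map_addHaar_eq_smul_addHaar μ ν
      (LinearMap.range_eq_top.1 hsurj)
    exact ⟨L.continuous.measurable, (show μ.map L = c • ν from hc) ▸
      Measure.smul_absolutelyContinuous⟩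
  refine measure_mono_null ?_ (hnull _ (hq.preimage_null hN'))
  rintro q ⟨hqU, hqN⟩
  refine ⟨hqU, ?_⟩
  rw [mem_preimage, hLh q] at hqN
  exact hqN

/-- A Lebesgue null set in a manifold is a null set in charts. -/
lemma IsLebesgueMeasure.volume_null {n : ℕ} {M : Type*} [TopologicalSpace M]
    [ChartedSpace (EuclideanSpace ℝ (Fin n)) M] [IsManifold (𝓡 n) ∞ M] [MeasurableSpace M]
    [BorelSpace M] {leb : Measure M} (hleb : IsLebesgueMeasure (n := n) leb) {N : Set M}
    (hN : MeasurableSet N) (h0 : leb N = 0) (ξ : M) :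
    volume ((extChartAt (𝓡 n) ξ).target ∩ (extChartAt (𝓡 n) ξ).symm ⁻¹' N) = 0 := by
  set e := chartAt (EuclideanSpace ℝ (Fin n)) ξ with he
  have htarget : (extChartAt (𝓡 n) ξ).target = e.target := by simp [he]
  have hsymm : ((extChartAt (𝓡 n) ξ).symm : EuclideanSpace ℝ (Fin n) → M) = e.symm := by
    simp [he]
  rw [htarget, hsymm]
  have hac := (hleb e (IsManifold.chart_mem_maximalAtlas ξ)).2
  classical
  -- The inverse chart is continuous only on its target, so it is first extended by a constant to a
  -- measurable map.
  have hmeas : MeasurableSet (e.target ∩ e.symm ⁻¹' N) := by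
    have := (e.continuousOn_symm.measurable_piecewise (g := fun _ => ξ) continuousOn_const
      e.open_target.measurableSet)
    have h2 := (this hN).inter e.open_target.measurableSet
    convert h2 using 1
    ext x
    by_cases hx : x ∈ e.target <;> simp [hx]
  have hae : AEMeasurable e (leb.restrict e.source) :=
    e.continuousOn.aemeasurable e.open_source.measurableSet
  have h1 : (leb.restrict e.source).map e (e.target ∩ e.symm ⁻¹' N) = 0 := by
    rw [Measure.map_apply_of_aemeasurable hae hmeas]
    rw [Measure.restrict_apply' e.open_source.measurableSet]
    refine measure_mono_null ?_ h0
    rintro x ⟨⟨-, hx⟩, hx'⟩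
    rwa [mem_preimage, e.left_inv hx'] at hx
  have h2 := hac h1
  rwa [Measure.restrict_apply hmeas, inter_assoc, inter_comm _ e.target, ← inter_assoc,
    inter_self] at h2

/-- A finite measure that is not singular has a nonzero absolutely continuous component. -/
theorem hasNonzeroACComponent_of_not_singular {X : Type*} [MeasurableSpace X] {Q μ : Measure X}
    [IsFiniteMeasure Q] (h : ∀ N, MeasurableSet N → μ N = 0 → Q Nᶜ ≠ 0) :
    HasNonzeroACComponent Q μ := by
  -- Exhaustion: a countable union of `μ`-null sets attains the largest `Q`-mass, and what remains
  -- of `Q` cannot charge a null set. No σ-finiteness of `μ` is needed.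
  let T : Set ENNReal := Q '' {N | MeasurableSet N ∧ μ N = 0}
  have hT : T.Nonempty := ⟨_, ∅, ⟨MeasurableSet.empty, measure_empty⟩, rfl⟩
  obtain ⟨a, -, ha, haT⟩ := exists_seq_tendsto_sSup hT (OrderTop.bddAbove T)
  choose N hN hNa using haT
  simp only [mem_ofPred_eq] at hN
  set Z := ⋃ j, N j with hZ
  have hZm : MeasurableSet Z := MeasurableSet.iUnion fun j => (hN j).1
  have hZ0 : μ Z = 0 := measure_iUnion_null fun j => (hN j).2
  have hmax : ∀ A, MeasurableSet A → μ A = 0 → Q A ≤ Q Z := fun A hA hA0 =>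
    (le_sSup (show Q A ∈ T from ⟨A, ⟨hA, hA0⟩, rfl⟩)).trans
      (le_of_tendsto' ha fun j => hNa j ▸ measure_mono (subset_iUnion N j))
  refine ⟨Q.restrict Zᶜ, Q.restrict Z, (Measure.restrict_compl_add_restrict hZm).symm, ?_, ?_, ?_⟩
  · refine Measure.AbsolutelyContinuous.mk fun A hA hA0 => ?_
    rw [Measure.restrict_apply hA]
    have h1 := hmax (Z ∪ A) (hZm.union hA) (measure_union_null hZ0 hA0)
    rw [← union_sdiff_self, measure_union disjoint_sdiff_right (hA.diff hZm)] at h1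
    have h2 : Q Z + Q (A \ Z) ≤ Q Z + 0 := by simpa using h1
    exact le_antisymm ((ENNReal.add_le_add_iff_left (measure_ne_top Q Z)).1 h2) zero_le
  · exact ⟨Zᶜ, hZm.compl, by rw [Measure.restrict_apply hZm.compl]; simp, by simpa using hZ0⟩
  · intro h0
    refine h Z hZm hZ0 ?_
    rw [← Measure.restrict_apply_univ, h0]
    rfl

end NullSets

/-! ### Finite-dimensional laws of the switching sequence -/

section PathLaw

open Preorder

variable {S : Type*}

/-- The sequence with regimes `r` and holding times `s`, continued by zero. -/
def pathOf {m : ℕ} (r : ℕ → S) (s : Fin m → ℝ) (l : ℕ) : S × ℝ :=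
  (r l, if h : l < m then s ⟨l, h⟩ else 0)

lemma pathOf_snocL_of_lt {m : ℕ} (r : ℕ → S) (z : (Fin m → ℝ) × ℝ) {l : ℕ} (hl : l < m) :
    pathOf r (snocL m z) l = pathOf r z.1 l := by
  have : snocL m z (Fin.castSucc ⟨l, hl⟩) = z.1 ⟨l, hl⟩ := congrFun (initL_snocL z) ⟨l, hl⟩
  simp only [pathOf, hl, hl.trans (Nat.lt_succ_self m), dif_pos]
  exact congrArg _ this

lemma pathOf_snocL_self {m : ℕ} (r : ℕ → S) (z : (Fin m → ℝ) × ℝ) :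
    pathOf r (snocL m z) m = (r m, z.2) := by
  simp only [pathOf, Nat.lt_succ_self m, dif_pos]
  exact congrArg _ (snocL_last z)

variable [MeasurableSpace S]

lemma measurable_pathOf {m : ℕ} (r : ℕ → S) : Measurable (pathOf r : (Fin m → ℝ) → ℕ → S × ℝ) := by
  refine measurable_pi_iff.2 fun l => ?_
  unfold pathOf
  split_ifs <;> fun_prop

lemma measurableSet_pathOf {m : ℕ} (r : ℕ → S) {p : (Finset.Iic m → S × ℝ) → Prop}
    (hp : MeasurableSet {x | p x}) :
    MeasurableSet {z : (Fin m → ℝ) × ℝ | (∀ l, 0 < snocL m z l) →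
      p (frestrictLe (π := fun _ => S × ℝ) m (pathOf r (snocL m z)))} := by
  have h1 : Measurable fun z : (Fin m → ℝ) × ℝ => snocL m z := (snocL m).continuous.measurable
  have h2 : MeasurableSet {z : (Fin m → ℝ) × ℝ | ∀ l, 0 < snocL m z l} := by
    rw [ofPred_forall]
    exact MeasurableSet.iInter fun l =>
      measurableSet_lt measurable_const ((measurable_pi_apply l).comp h1)
  have h3 : Measurable fun z : (Fin m → ℝ) × ℝ =>
      frestrictLe (π := fun _ => S × ℝ) m (pathOf r (snocL m z)) :=
    (measurable_frestrictLe m).comp ((measurable_pathOf r).comp h1)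
  exact h2.imp (h3 hp)

variable [DiscreteMeasurableSpace S] [Countable S]

lemma map_frestrictLe_zero_trajMeasure {X : ℕ → Type*} [∀ n, MeasurableSpace (X n)]
    {κ : (n : ℕ) → Kernel ((i : Finset.Iic n) → X i) (X (n + 1))} [∀ n, IsMarkovKernel (κ n)]
    {μ₀ : Measure (X 0)} [IsProbabilityMeasure μ₀] :
    (Kernel.trajMeasure μ₀ κ).map (frestrictLe 0) =
      μ₀.map (MeasurableEquiv.piUnique fun i : Finset.Iic 0 => X i).symm := by
  rw [Kernel.trajMeasure, Measure.map_comp _ _ (by fun_prop), Kernel.traj_map_frestrictLe,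
    Kernel.partialTraj_self, Measure.id_comp]
  rfl

/-- An event that is almost sure for the exponential law is Lebesgue almost sure on `(0, ∞)`. -/
lemma ae_volume_of_ae_holding (R : SwitchingLaw S) {i : S} {p : ℝ → Prop}
    (h : ∀ᵐ t ∂(R.holding i), p t) : ∀ᵐ t : ℝ, 0 < t → p t := by
  have h1 : ∀ᵐ t ∂(volume : Measure ℝ).withDensity (gammaPDF 1 (R.rate i)), p t := h
  have hm : Measurable (gammaPDF 1 (R.rate i)) :=
    (measurable_gammaPDFReal 1 (R.rate i)).ennreal_ofReal
  rw [ae_withDensity_iff hm] at h1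
  filter_upwards [h1] with t ht h0
  exact ht (ENNReal.ofReal_pos.2 (gammaPDFReal_pos one_pos (R.rate_pos i) h0)).ne'

/-- The regime `j` is an atom of the jump law, so an almost sure statement over the next regime
holds at `j` itself. -/
lemma ae_holding_of_ae_step (R : SwitchingLaw S) {i j : S} (hij : 0 < R.jump i j) {t : ℝ}
    {p : S × ℝ → Prop} (h : ∀ᵐ y ∂(R.step (i, t)), p y) : ∀ᵐ t ∂(R.holding j), p (j, t) := by
  have h1 : ∀ᵐ y ∂(R.jumpKernel ⊗ₖ Kernel.prodMkLeft S R.holding) i, p y := h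
  have h2 := Kernel.ae_ae_of_ae_compProd h1
  have h3 : ∀ᵐ b ∂(R.jump i).toMeasure, ∀ᵐ t ∂(R.holding b), p (b, t) := h2
  refine (ae_iff_of_countable.1 h3) j ?_
  rw [PMF.toMeasure_apply_singleton _ _ (measurableSet_singleton j)]
  exact hij.ne'

/-- Almost sure statements on tuples, by splitting off the last entry. -/
lemma ae_tuple_iff {m : ℕ} {p : (Fin (m + 1) → ℝ) → Prop} :
    (∀ᵐ s, p s) ↔ ∀ᵐ z : (Fin m → ℝ) × ℝ, p (snocL m z) := by
  let e := MeasurableEquiv.piFinSuccAbove (fun _ : Fin (m + 1) => ℝ) (Fin.last m)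
  have he : MeasurePreserving e := volume_preserving_piFinSuccAbove (fun _ => ℝ) (Fin.last m)
  have hs : MeasurePreserving (Prod.swap : ℝ × (Fin m → ℝ) → (Fin m → ℝ) × ℝ) :=
    Measure.measurePreserving_swap
  let e' := e.trans MeasurableEquiv.prodComm
  have he' : MeasurePreserving e' := hs.comp he
  have hinv : ∀ z, e'.symm z = snocL m z := by
    intro z
    rw [MeasurableEquiv.symm_apply_eq]
    refine Prod.ext ?_ ?_
    · ext l
      have : (snocL m z) l.castSucc = z.1 l := congrFun (initL_snocL z) l
      change _ = snocL m z ((Fin.last m).succAbove l)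
      rw [Fin.succAbove_last, this]
    · change _ = snocL m z (Fin.last m)
      simp
  rw [← (he'.symm).map_eq, e'.symm.measurableEmbedding.ae_map_iff]
  simp only [hinv]

/-- Appending an entry to a finite sequence. -/
def appendIic {X : Type*} (m : ℕ) (z : (Finset.Iic m → X) × X) (l : Finset.Iic (m + 1)) : X :=
  if h : l.1 ≤ m then z.1 ⟨l.1, Finset.mem_Iic.2 h⟩ else z.2

lemma measurable_appendIic {X : Type*} [MeasurableSpace X] (m : ℕ) :
    Measurable (appendIic (X := X) m) := by
  refine measurable_pi_iff.2 fun l => ?_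
  unfold appendIic
  split_ifs <;> fun_prop

lemma appendIic_frestrictLe {X : Type*} {m : ℕ} (w : ℕ → X) :
    appendIic m (frestrictLe (π := fun _ => X) m w, w (m + 1)) =
      frestrictLe (π := fun _ => X) (m + 1) w := by
  ext l
  by_cases h : l.1 ≤ m
  · simp [appendIic, h]
  · have : l.1 = m + 1 := by have := Finset.mem_Iic.1 l.2; omega
    simp [appendIic, this]

/-- An almost sure property of the first regimes and holding times holds for Lebesgue almost all
positive holding times, if the regimes can follow each other. -/
theorem ae_pathOf_of_ae_pathLaw (R : SwitchingLaw S) {r : ℕ → S} {m : ℕ}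
    (hr : ∀ l < m, 0 < R.jump (r l) (r (l + 1))) {p : (Finset.Iic m → S × ℝ) → Prop}
    (hp : MeasurableSet {x | p x})
    (h : ∀ᵐ w ∂(R.pathLaw (r 0)), p (frestrictLe (π := fun _ => S × ℝ) m w)) :
    ∀ᵐ s : Fin (m + 1) → ℝ, (∀ l, 0 < s l) →
      p (frestrictLe (π := fun _ => S × ℝ) m (pathOf r s)) := by
  induction m with
  | zero =>
    have h1 : ∀ᵐ x ∂(R.pathLaw (r 0)).map (frestrictLe (π := fun _ => S × ℝ) 0), p x :=
      (ae_map_iff (by fun_prop) hp).2 h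
    rw [SwitchingLaw.pathLaw, map_frestrictLe_zero_trajMeasure (X := fun _ => S × ℝ)] at h1
    have h2 := ae_of_ae_map (by fun_prop) h1
    have h3 := Measure.ae_ae_of_ae_compProd h2
    rw [ae_dirac_eq] at h3
    have h4 := ae_volume_of_ae_holding R h3
    rw [ae_tuple_iff]
    refine (Measure.ae_prod_iff_ae_ae (measurableSet_pathOf r hp)).2 ?_
    · refine Filter.Eventually.of_forall fun q => ?_
      filter_upwards [h4] with t ht hpos
      have h0 : 0 < t := (hpos (Fin.last 0)).trans_eq (snocL_last (q, t))
      convert ht h0 using 1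
      funext l
      have hl : l = ⟨0, Finset.mem_Iic.2 le_rfl⟩ :=
        Subtype.ext (Nat.le_zero.1 (Finset.mem_Iic.1 l.2))
      rw [hl]
      exact pathOf_snocL_self r (q, t)
  | succ m ih =>
    have h1 : ∀ᵐ z ∂(R.pathLaw (r 0)).map
        (fun w => (frestrictLe (π := fun _ => S × ℝ) m w, w (m + 1))), p (appendIic m z) := by
      refine (ae_map_iff (by fun_prop) (measurable_appendIic m hp)).2 ?_
      filter_upwards [h] with w hw
      rwa [appendIic_frestrictLe]
    rw [SwitchingLaw.pathLaw,
      ← Kernel.map_frestrictLe_trajMeasure_compProd_eq_map_trajMeasure (X := fun _ => S × ℝ)] at h1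
    have h2 := Measure.ae_ae_of_ae_compProd h1
    -- The induction hypothesis is applied to the event on the past that the next pair almost surely
    -- completes it to a sequence with property `p`.
    have hm : MeasurableSet {x : Finset.Iic m → S × ℝ |
        ∀ᵐ y ∂(R.stepKernel m x), p (appendIic m (x, y))} :=
      Kernel.measurable_kernel_prodMk_left (κ := R.stepKernel m)
        (measurable_appendIic m hp).compl (measurableSet_singleton 0)
    have h3 := ih (fun l hl => hr l (by omega)) hm (ae_of_ae_map (by fun_prop) h2)
    rw [ae_tuple_iff]
    refine (Measure.ae_prod_iff_ae_ae (measurableSet_pathOf r hp)).2 ?_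
    filter_upwards [h3] with q hq
    by_cases hq0 : ∀ l, 0 < q l
    · have h4 : ∀ᵐ y ∂(R.step (pathOf r q m)), p (appendIic m
          (frestrictLe (π := fun _ => S × ℝ) m (pathOf r q), y)) := hq hq0
      have h5 := ae_volume_of_ae_holding R (ae_holding_of_ae_step R (hr m (by omega)) h4)
      filter_upwards [h5] with t ht hpos
      have := ht (by simpa using hpos (Fin.last _))
      rw [← appendIic_frestrictLe, pathOf_snocL_self]
      have hi : frestrictLe (π := fun _ => S × ℝ) m (pathOf r (snocL (m + 1) (q, t))) =
          frestrictLe (π := fun _ => S × ℝ) m (pathOf r q) := by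
        funext l
        exact pathOf_snocL_of_lt r (q, t) (Nat.lt_succ_of_le (Finset.mem_Iic.1 l.2))
      rwa [hi]
    · refine Filter.Eventually.of_forall fun t hpos => absurd (fun l => ?_) hq0
      have := hpos l.castSucc
      rwa [show snocL (m + 1) (q, t) l.castSucc = q l from
        congrFun (initL_snocL (q, t)) l] at this

end PathLaw

/-! ### The process between two switches -/

section Deterministic

variable {S : Type*}

lemma switchTime_succ (w : ℕ → S × ℝ) (m : ℕ) :
    switchTime w (m + 1) = switchTime w m + (w m).2 :=
  Finset.sum_range_succ _ _

lemma switchTime_mono {w : ℕ → S × ℝ} {m : ℕ} (hw : ∀ l < m, 0 < (w l).2) {j : ℕ} (hj : j ≤ m) :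
    switchTime w j ≤ switchTime w m :=
  Finset.sum_le_sum_of_subset_of_nonneg (Finset.range_mono hj) fun l hl _ =>
    (hw l (Finset.mem_range.1 hl)).le

lemma switchTime_nonneg {w : ℕ → S × ℝ} {m : ℕ} (hw : ∀ l < m, 0 < (w l).2) :
    0 ≤ switchTime w m :=
  switchTime_mono hw (Nat.zero_le m)

/-- The index `m` qualifies, and every `j < m` has its next switch no later than the `m`-th. Holding
times from `m + 1` on play no role. -/
lemma switchCount_switchTime_add {w : ℕ → S × ℝ} {m : ℕ} (hw : ∀ l < m, 0 < (w l).2) {τ : ℝ}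
    (h0 : 0 ≤ τ) (hτ : τ < (w m).2) : switchCount w (switchTime w m + τ) = m := by
  have hm : switchTime w m + τ < switchTime w (m + 1) := by
    rw [switchTime_succ]
    linarith
  refine le_antisymm (Nat.sInf_le hm) (le_csInf ⟨m, hm⟩ fun j hj => ?_)
  by_contra! hjm
  have h1 : switchTime w m + τ < switchTime w (j + 1) := hj
  have h2 := switchTime_mono hw (Nat.succ_le_of_lt hjm)
  rw [Nat.succ_eq_add_one] at h2
  linarith

variable {n : ℕ} {M : Type*} [TopologicalSpace M] [ChartedSpace (EuclideanSpace ℝ (Fin n)) M]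
  {u : S → (x : M) → TangentSpace (𝓡 n) x} {ξ : M}

lemma switchPosition_congr {w w' : ℕ → S × ℝ} {m : ℕ} (h : ∀ l < m, w l = w' l) :
    switchPosition u ξ w m = switchPosition u ξ w' m := by
  induction m with
  | zero => rfl
  | succ m ih =>
    simp only [switchPosition]
    rw [h m (Nat.lt_succ_self m), ih fun l hl => h l (hl.trans (Nat.lt_succ_self m))]

lemma switchPosition_pathOf_snocL {m : ℕ} (r : ℕ → S) (z : (Fin m → ℝ) × ℝ) :
    switchPosition u ξ (pathOf r (snocL m z)) (m + 1) =
      flow (u (r m)) z.2 (switchPosition u ξ (pathOf r z.1) m) := by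
  simp only [switchPosition]
  rw [pathOf_snocL_self, switchPosition_congr fun l hl => pathOf_snocL_of_lt r z hl]

lemma positionAt_switchTime_add {w : ℕ → S × ℝ} {m : ℕ} (hw : ∀ l < m, 0 < (w l).2) {τ : ℝ}
    (h0 : 0 ≤ τ) (hτ : τ < (w m).2) :
    positionAt u ξ w (switchTime w m + τ) = flow (u (w m).1) τ (switchPosition u ξ w m) := by
  simp only [positionAt, regimeAt]
  rw [switchCount_switchTime_add hw h0 hτ, add_sub_cancel_left]

/-- A continuation of a finite sequence to an infinite one. -/
def extendIic {X : Type*} (m : ℕ) (x : Finset.Iic m → X) (l : ℕ) : X :=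
  x ⟨min l m, Finset.mem_Iic.2 (min_le_right l m)⟩

lemma extendIic_frestrictLe {X : Type*} {m : ℕ} (w : ℕ → X) {l : ℕ} (hl : l ≤ m) :
    extendIic m (Preorder.frestrictLe (π := fun _ => X) m w) l = w l := by
  simp [extendIic, hl]

/-- The property of a path that almost the whole `m`-th sojourn is spent in `N`. -/
def SojournIn (u : S → (x : M) → TangentSpace (𝓡 n) x) (ξ : M) (N : Set (M × S)) (m : ℕ)
    (w : ℕ → S × ℝ) : Prop :=
  (∀ l < m, 0 < (w l).2) → ∀ᵐ τ : ℝ, 0 < τ → τ < (w m).2 →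
    (flow (u (w m).1) τ (switchPosition u ξ w m), (w m).1) ∈ N

lemma sojournIn_congr {N : Set (M × S)} {m : ℕ} {w w' : ℕ → S × ℝ}
    (h : ∀ l ≤ m, w l = w' l) : SojournIn u ξ N m w ↔ SojournIn u ξ N m w' := by
  have h1 : (∀ l < m, 0 < (w l).2) ↔ ∀ l < m, 0 < (w' l).2 :=
    forall₂_congr fun l hl => by rw [h l hl.le]
  unfold SojournIn
  rw [h1, h m le_rfl, switchPosition_congr fun l hl => h l hl.le]

end Deterministic

/-! ### Measurability of the switching process -/

lemma measurable_sInf_nat {α : Type*} [MeasurableSpace α] {A : ℕ → Set α}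
    (hA : ∀ m, MeasurableSet (A m)) : Measurable fun x => sInf {m | x ∈ A m} := by
  classical
  -- The infimum of the empty set is `0`. Declaring every index admissible in that case makes
  -- `Nat.find` agree with it.
  let p : α → ℕ → Prop := fun x m => x ∈ A m ∨ ∀ j, x ∉ A j
  have hp : ∀ x, ∃ m, p x m := by
    intro x
    by_cases h : ∃ m, x ∈ A m
    · exact ⟨h.choose, Or.inl h.choose_spec⟩
    · exact ⟨0, Or.inr (not_exists.1 h)⟩
  have h0 : MeasurableSet {x | ∀ j, x ∉ A j} := by
    rw [Set.ofPred_forall]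
    exact MeasurableSet.iInter fun j => (hA j).compl
  have hm : ∀ m, MeasurableSet {x | p x m} := fun m => (hA m).union h0
  convert measurable_find hp hm using 2 with x
  by_cases h : ∃ m, x ∈ A m
  · refine le_antisymm (Nat.sInf_le ?_) (Nat.find_min' _ (Or.inl (Nat.sInf_mem (s := {m | x ∈ A m}) h)))
    exact (Nat.find_spec (hp x)).resolve_right fun h' => h' _ h.choose_spec
  · have h0 : {m | x ∈ A m} = ∅ := by ext m; simpa using not_exists.1 h m
    rw [h0, Nat.sInf_empty]
    exact ((Nat.find_eq_zero (hp x)).2 (Or.inr (not_exists.1 h))).symm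

section Paths

variable {S : Type*} [MeasurableSpace S]

lemma measurable_switchTime (m : ℕ) : Measurable fun w : ℕ → S × ℝ => switchTime w m := by
  unfold switchTime
  fun_prop

lemma measurable_switchCount :
    Measurable fun p : ℝ × (ℕ → S × ℝ) => switchCount p.2 p.1 :=
  measurable_sInf_nat (A := fun m => {p : ℝ × (ℕ → S × ℝ) | p.1 < switchTime p.2 (m + 1)})
    fun m => measurableSet_lt measurable_fst ((measurable_switchTime (m + 1)).comp measurable_snd)

lemma measurable_regimeAt : Measurable fun p : ℝ × (ℕ → S × ℝ) => regimeAt p.2 p.1 := by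
  have h : Measurable fun q : ℕ × (ℕ → S × ℝ) => (q.2 q.1).1 :=
    measurable_from_prod_countable_right fun m => by fun_prop
  exact h.comp (measurable_switchCount.prodMk measurable_snd)

variable {n : ℕ} {M : Type*} [TopologicalSpace M] [T2Space M] [SecondCountableTopology M]
  [ChartedSpace (EuclideanSpace ℝ (Fin n)) M] [IsManifold (𝓡 n) ∞ M] [MeasurableSpace M]
  [BorelSpace M]

/-- A Carathéodory argument: the flow is continuous in time and measurable in space, and `M` is
metrizable. -/
lemma measurable_uncurry_flow {v : (x : M) → TangentSpace (𝓡 n) x} (hv : IsSmoothField v)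
    (hc : ForwardComplete v) : Measurable fun p : ℝ × M => flow v p.1 p.2 := by
  have : LocallyCompactSpace M := ChartedSpace.locallyCompactSpace (EuclideanSpace ℝ (Fin n)) M
  have : TopologicalSpace.MetrizableSpace M := Manifold.metrizableSpace (𝓡 n) M
  exact measurable_uncurry_of_continuous_of_measurable (u := flow v)
    (fun η => continuous_flow_time hc η) fun t => (continuous_flow hv hc t).measurable

variable [Countable S] [DiscreteMeasurableSpace S] {u : S → (x : M) → TangentSpace (𝓡 n) x}

lemma measurable_regime_flow (hsmooth : ∀ i, IsSmoothField (u i))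
    (hcomplete : ∀ i, ForwardComplete (u i)) :
    Measurable fun p : S × ℝ × M => flow (u p.1) p.2.1 p.2.2 :=
  measurable_from_prod_countable_right fun i =>
    measurable_uncurry_flow (hsmooth i) (hcomplete i)

lemma measurable_switchPosition (hsmooth : ∀ i, IsSmoothField (u i))
    (hcomplete : ∀ i, ForwardComplete (u i)) (ξ : M) (m : ℕ) :
    Measurable fun w => switchPosition u ξ w m := by
  induction m with
  | zero => exact measurable_const
  | succ m ih =>
    exact (measurable_regime_flow hsmooth hcomplete).comp
      (f := fun w : ℕ → S × ℝ => ((w m).1, (w m).2, switchPosition u ξ w m))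
      (by fun_prop)

lemma measurable_positionAt (hsmooth : ∀ i, IsSmoothField (u i))
    (hcomplete : ∀ i, ForwardComplete (u i)) (ξ : M) :
    Measurable fun p : ℝ × (ℕ → S × ℝ) => positionAt u ξ p.2 p.1 := by
  have hc : Measurable fun p : ℝ × (ℕ → S × ℝ) => (switchCount p.2 p.1, p.2) :=
    measurable_switchCount.prodMk measurable_snd
  have h1 : Measurable fun q : ℕ × (ℕ → S × ℝ) => switchTime q.2 q.1 :=
    measurable_from_prod_countable_right measurable_switchTime
  have h2 : Measurable fun q : ℕ × (ℕ → S × ℝ) => switchPosition u ξ q.2 q.1 :=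
    measurable_from_prod_countable_right (measurable_switchPosition hsmooth hcomplete ξ)
  exact (measurable_regime_flow hsmooth hcomplete).comp
    (measurable_regimeAt.prodMk ((measurable_fst.sub (h1.comp hc)).prodMk (h2.comp hc)))

lemma measurable_positionAt_regimeAt (hsmooth : ∀ i, IsSmoothField (u i))
    (hcomplete : ∀ i, ForwardComplete (u i)) (ξ : M) :
    Measurable fun p : ℝ × (ℕ → S × ℝ) => (positionAt u ξ p.2 p.1, regimeAt p.2 p.1) :=
  (measurable_positionAt hsmooth hcomplete ξ).prodMk measurable_regimeAt

instance isProbabilityMeasure_pathLaw (R : SwitchingLaw S) (i : S) :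
    IsProbabilityMeasure (R.pathLaw i) := by
  unfold SwitchingLaw.pathLaw
  infer_instance

lemma isProbabilityMeasure_transition (hsmooth : ∀ i, IsSmoothField (u i))
    (hcomplete : ∀ i, ForwardComplete (u i)) (R : SwitchingLaw S) (ξ : M) (i : S) (t : ℝ) :
    IsProbabilityMeasure (transition u R ξ i t) :=
  Measure.isProbabilityMeasure_map
    ((measurable_positionAt_regimeAt hsmooth hcomplete ξ).comp measurable_prodMk_left).aemeasurable

lemma measurable_transition (hsmooth : ∀ i, IsSmoothField (u i))
    (hcomplete : ∀ i, ForwardComplete (u i)) (R : SwitchingLaw S) (ξ : M) (i : S) :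
    Measurable (transition u R ξ i) := by
  have hX := measurable_positionAt_regimeAt hsmooth hcomplete ξ
  refine Measure.measurable_of_measurable_coe _ fun A hA => ?_
  have : ∀ t, transition u R ξ i t A = R.pathLaw i (Prod.mk t ⁻¹'
      ((fun p : ℝ × (ℕ → S × ℝ) => (positionAt u ξ p.2 p.1, regimeAt p.2 p.1)) ⁻¹' A)) :=
    fun t => Measure.map_apply (hX.comp measurable_prodMk_left) hA
  simp only [this]
  exact measurable_measure_prodMk_left (hX hA)

lemma isFiniteMeasure_resolvent (hsmooth : ∀ i, IsSmoothField (u i))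
    (hcomplete : ∀ i, ForwardComplete (u i)) (R : SwitchingLaw S) (ξ : M) (i : S) :
    IsFiniteMeasure (resolvent u R ξ i) := by
  let κ : Kernel ℝ (M × S) := ⟨transition u R ξ i, measurable_transition hsmooth hcomplete R ξ i⟩
  have hκ : IsMarkovKernel κ := ⟨isProbabilityMeasure_transition hsmooth hcomplete R ξ i⟩
  have hμ : IsFiniteMeasure ((volume.restrict (Ioi (0 : ℝ))).withDensity
      fun t => ENNReal.ofReal (Real.exp (-t))) :=
    isFiniteMeasure_withDensity_ofReal (integrableOn_exp_neg_Ioi 0).2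
  change IsFiniteMeasure (κ ∘ₘ _)
  infer_instance

/-! ### From full resolvent mass to Lebesgue almost all holding times -/

/-- If the resolvent does not charge the complement of `N`, then almost every path spends almost
all its time in `N`. -/
lemma ae_ae_mem_of_resolvent_compl_eq_zero (hsmooth : ∀ i, IsSmoothField (u i))
    (hcomplete : ∀ i, ForwardComplete (u i)) {R : SwitchingLaw S} {ξ : M} {i : S}
    {N : Set (M × S)} (hN : MeasurableSet N) (h : resolvent u R ξ i Nᶜ = 0) :
    ∀ᵐ w ∂(R.pathLaw i), ∀ᵐ t : ℝ, 0 < t → (positionAt u ξ w t, regimeAt w t) ∈ N := by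
  have hX := measurable_positionAt_regimeAt (S := S) hsmooth hcomplete ξ
  have h1 : ∀ᵐ x ∂(resolvent u R ξ i), x ∈ N := h
  have h2 := Measure.ae_ae_of_ae_bind (measurable_transition hsmooth hcomplete R ξ i).aemeasurable h1
  -- The weight `e^{-t}` is positive, so it can be dropped; Fubini then exchanges times and paths.
  rw [ae_withDensity_iff (by fun_prop), ae_restrict_iff' measurableSet_Ioi] at h2
  have h3 : ∀ᵐ t : ℝ, ∀ᵐ w ∂(R.pathLaw i), 0 < t → (positionAt u ξ w t, regimeAt w t) ∈ N := by
    filter_upwards [h2] with t ht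
    by_cases h0 : 0 < t
    · have := ht h0 (ENNReal.ofReal_pos.2 (Real.exp_pos _)).ne'
      filter_upwards [ae_of_ae_map (hX.comp measurable_prodMk_left).aemeasurable this] with w hw _
      exact hw
    · exact Filter.Eventually.of_forall fun w h => absurd h h0
  refine (Measure.ae_ae_comm ?_).1 h3
  exact (measurableSet_lt measurable_const measurable_fst).imp (hX hN)

lemma measurableSet_sojournIn (hsmooth : ∀ i, IsSmoothField (u i))
    (hcomplete : ∀ i, ForwardComplete (u i)) {ξ : M} {N : Set (M × S)} (hN : MeasurableSet N)
    (m : ℕ) : MeasurableSet {w | SojournIn u ξ N m w} := by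
  have h1 : MeasurableSet {w : ℕ → S × ℝ | ∀ l < m, 0 < (w l).2} := by
    simp only [Set.ofPred_forall]
    exact MeasurableSet.iInter fun l => MeasurableSet.iInter fun _ =>
      measurableSet_lt measurable_const (by fun_prop)
  have hX : Measurable fun p : (ℕ → S × ℝ) × ℝ =>
      (flow (u (p.1 m).1) p.2 (switchPosition u ξ p.1 m), (p.1 m).1) := by
    have hS := (measurable_switchPosition hsmooth hcomplete ξ m).comp
      (measurable_fst : Measurable (Prod.fst : (ℕ → S × ℝ) × ℝ → _))
    have hr : Measurable fun p : (ℕ → S × ℝ) × ℝ => (p.1 m).1 := by fun_prop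
    exact ((measurable_regime_flow hsmooth hcomplete).comp
      (hr.prodMk (measurable_snd.prodMk hS))).prodMk hr
  have hB : MeasurableSet {p : (ℕ → S × ℝ) × ℝ | 0 < p.2 → p.2 < (p.1 m).2 →
      (flow (u (p.1 m).1) p.2 (switchPosition u ξ p.1 m), (p.1 m).1) ∈ N} :=
    (measurableSet_lt measurable_const measurable_snd).imp
      ((measurableSet_lt measurable_snd (by fun_prop)).imp (hX hN))
  exact h1.imp ((measurable_measure_prodMk_left (ν := (volume : Measure ℝ)) hB.compl)
    (measurableSet_singleton 0))

/-- Translation by the `m`-th switch time preserves null sets, so almost all times `t` become almost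
all elapsed times `τ` of the sojourn. -/
lemma ae_sojournIn (hsmooth : ∀ i, IsSmoothField (u i))
    (hcomplete : ∀ i, ForwardComplete (u i)) {R : SwitchingLaw S} {ξ : M} {i : S}
    {N : Set (M × S)} (hN : MeasurableSet N) (h : resolvent u R ξ i Nᶜ = 0) (m : ℕ) :
    ∀ᵐ w ∂(R.pathLaw i), SojournIn u ξ N m w := by
  filter_upwards [ae_ae_mem_of_resolvent_compl_eq_zero hsmooth hcomplete hN h] with w hw hpos
  have := (measurePreserving_add_left volume (switchTime w m)).quasiMeasurePreserving.ae hw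
  filter_upwards [this] with τ hτ h0 h1
  have h2 := hτ (add_pos_of_nonneg_of_pos (switchTime_nonneg hpos) h0)
  rw [positionAt_switchTime_add hpos h0.le h1] at h2
  simpa only [regimeAt, switchCount_switchTime_add hpos h0.le h1] using h2

/-- If the resolvent does not charge the complement of `N`, then for every possible sequence of
regimes and almost all holding times the process is in `N`. -/
theorem ae_switchPosition_mem_of_resolvent_compl_eq_zero (hsmooth : ∀ i, IsSmoothField (u i))
    (hcomplete : ∀ i, ForwardComplete (u i)) {R : SwitchingLaw S} {ξ : M} {N : Set (M × S)}
    (hN : MeasurableSet N) {r : ℕ → S} {m : ℕ}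
    (hr : ∀ l < m, 0 < R.jump (r l) (r (l + 1))) (h : resolvent u R ξ (r 0) Nᶜ = 0)
    (T : ℝ) : ∀ᵐ s : Fin (m + 1) → ℝ, (∀ l, 0 < s l) → s (Fin.last m) < T →
      (switchPosition u ξ (pathOf r s) (m + 1), r m) ∈ N := by
  have hext : Measurable (extendIic (X := S × ℝ) m) :=
    measurable_pi_iff.2 fun l => measurable_pi_apply _
  have h1 := ae_pathOf_of_ae_pathLaw R hr (p := fun x => SojournIn u ξ N m (extendIic m x))
    (hext (measurableSet_sojournIn hsmooth hcomplete hN m)) (by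
      filter_upwards [ae_sojournIn hsmooth hcomplete hN h m] with w hw
      exact (sojournIn_congr fun l hl => extendIic_frestrictLe w hl).2 hw)
  rw [ae_tuple_iff] at h1 ⊢
  have hm : MeasurableSet {z : (Fin m → ℝ) × ℝ | (∀ l, 0 < snocL m z l) →
      snocL m z (Fin.last m) < T →
      (switchPosition u ξ (pathOf r (snocL m z)) (m + 1), r m) ∈ N} := by
    have h1 : Measurable fun z : (Fin m → ℝ) × ℝ => snocL m z := (snocL m).continuous.measurable
    have h2 : MeasurableSet {z : (Fin m → ℝ) × ℝ | ∀ l, 0 < snocL m z l} := by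
      rw [Set.ofPred_forall]
      exact MeasurableSet.iInter fun l =>
        measurableSet_lt measurable_const ((measurable_pi_apply l).comp h1)
    refine h2.imp ((measurableSet_lt ((measurable_pi_apply _).comp h1) measurable_const).imp ?_)
    exact (((measurable_switchPosition hsmooth hcomplete ξ (m + 1)).comp
      ((measurable_pathOf r).comp h1)).prodMk measurable_const) hN
  refine (Measure.ae_prod_iff_ae_ae hm).2 ?_
  filter_upwards [Measure.ae_ae_of_ae_prod h1] with q hq
  by_cases hq0 : ∀ l, 0 < q l
  -- A sojourn of some length `t > T` passes through all elapsed times `τ < T`, and its position at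
  -- `τ` is the endpoint with last holding time `τ`. One good `t` thus settles almost all `τ < T`.
  · have hf : ∃ᵐ t : ℝ, t ∈ Ioi (max T 0) := frequently_ae_mem_iff.2 (by simp)
    obtain ⟨t, ht1, ht⟩ := (hf.and_eventually hq).exists
    have hpos : ∀ l, 0 < snocL m (q, t) l := by
      refine Fin.lastCases ?_ fun l => ?_
      · rw [snocL_last]
        exact (le_max_right T 0).trans_lt ht1
      · rw [show snocL m (q, t) l.castSucc = q l from congrFun (initL_snocL (q, t)) l]
        exact hq0 l
    have h2 := (sojournIn_congr (w' := pathOf r (snocL m (q, t)))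
      fun l hl => extendIic_frestrictLe _ hl).1 (ht hpos) (fun l hl => by
        rw [pathOf_snocL_of_lt r _ hl]
        simpa [pathOf, hl] using hq0 ⟨l, hl⟩)
    rw [pathOf_snocL_self, switchPosition_congr fun l hl => pathOf_snocL_of_lt r _ hl] at h2
    filter_upwards [h2] with τ hτ hτ0 hτ1
    rw [snocL_last] at hτ1
    rw [switchPosition_pathOf_snocL]
    exact hτ ((hτ0 (Fin.last m)).trans_eq (snocL_last (q, τ))) (hτ1.trans ((le_max_left T 0).trans_lt ht1))
  · refine Filter.Eventually.of_forall fun t hpos => absurd (fun l => ?_) hq0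
    exact (hpos l.castSucc).trans_eq (congrFun (initL_snocL (q, t)) l)

end Paths

/-! ### The absolutely continuous component of the resolvent -/

section Resolvent

open Topology

variable {n : ℕ} {M : Type*} [TopologicalSpace M]
  [ChartedSpace (EuclideanSpace ℝ (Fin n)) M]

/-- In a chart, the positions at the switches are endpoints of concatenated local flows. -/
lemma switchPosition_pathOf_eq_flowChain {S : Type*} {u : S → (x : M) → TangentSpace (𝓡 n) x}
    {ξ : M} {ψ : S → ℝ × EuclideanSpace ℝ (Fin n) → EuclideanSpace ℝ (Fin n)} {ε : ℝ}
    {W : Set (EuclideanSpace ℝ (Fin n))}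
    (hflow : ∀ l, ∀ x ∈ W, ∀ t ∈ Ico 0 ε, flow (u l) t ((extChartAt (𝓡 n) ξ).symm x) =
      (extChartAt (𝓡 n) ξ).symm (ψ l (t, x)))
    {r : ℕ → S} {m : ℕ} {s : Fin m → ℝ}
    (hs : s ∈ flowChainDomain ψ (extChartAt (𝓡 n) ξ ξ) ε W r m) :
    switchPosition u ξ (pathOf r s) m =
      (extChartAt (𝓡 n) ξ).symm (flowChain ψ (extChartAt (𝓡 n) ξ ξ) r m s) := by
  induction m with
  | zero => exact (extChartAt_to_inv ξ).symm
  | succ m ih =>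
    obtain ⟨z, rfl⟩ : ∃ z, s = snocL m z := ⟨_, (snocL_initL s).symm⟩
    obtain ⟨h1, h2, h3⟩ := hs
    simp only [initL_snocL, snocL_last] at h1 h2 h3
    rw [switchPosition_pathOf_snocL, ih h1, hflow _ _ h2 _ ⟨h3.1.le, h3.2⟩]
    simp only [flowChain, initL_snocL, snocL_last]

/-- Under Condition B, a set of full resolvent measure is not a Lebesgue null set. -/
theorem resolvent_compl_ne_zero_of_null [T2Space M] [SecondCountableTopology M]
    [IsManifold (𝓡 n) ∞ M] [MeasurableSpace M] [BorelSpace M] {S : Type*} [Finite S]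
    [MeasurableSpace S] [DiscreteMeasurableSpace S] {u : S → (x : M) → TangentSpace (𝓡 n) x}
    (hsmooth : ∀ i, IsSmoothField (u i)) (hcomplete : ∀ i, ForwardComplete (u i))
    (R : SwitchingLaw S) {leb : Measure M} (hleb : IsLebesgueMeasure (n := n) leb) {ξ : M}
    (hB : ConditionB u ξ) (i : S) {N : Set (M × S)} (hN : MeasurableSet N)
    (h0 : (leb.prod Measure.count) N = 0) : resolvent u R ξ i Nᶜ ≠ 0 := by
  intro h
  obtain ⟨ψ, ε, W, hε, hW, hWt, hψ, hflow, r, m, rfl, hr, s, hs, hsW, hsurj⟩ :=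
    exists_submersive_regimes hsmooth hcomplete hB (adm := fun i j => 0 < R.jump i j) R.jump_pos i
  have hF := contDiffAt_flowChain hε hψ hs
  obtain ⟨U, hU, hUnull⟩ := exists_nhds_preimage_null (volume : Measure (Fin (m + 1) → ℝ))
    (volume : Measure (EuclideanSpace ℝ (Fin n))) (hF.of_le one_le_two) hsurj
  have hNr : MeasurableSet {x | (x, r m) ∈ N} := measurable_prodMk_right hN
  have hNr0 : leb {x | (x, r m) ∈ N} = 0 := by
    have h1 : (leb.prod Measure.count) ({x | (x, r m) ∈ N} ×ˢ {r m}) = 0 := by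
      refine measure_mono_null ?_ h0
      rintro ⟨x, l⟩ ⟨hx, rfl⟩
      exact hx
    simpa using h1
  have hnull := hUnull _ (hleb.volume_null hNr hNr0 ξ)
  -- The bound `s (Fin.last m) + 1` serves as `T`; anything above the last entry of `s` would do.
  have hev : ∀ᶠ q in 𝓝 s, q ∈ U ∧ q ∈ flowChainDomain ψ (extChartAt (𝓡 n) ξ ξ) ε W r (m + 1) ∧
      flowChain ψ (extChartAt (𝓡 n) ξ ξ) r (m + 1) q ∈ W ∧
      q (Fin.last m) < s (Fin.last m) + 1 := by
    filter_upwards [hU, (isOpen_flowChainDomain hε hW hψ r (m + 1)).mem_nhds hs,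
      hF.continuousAt.eventually (hW.mem_nhds hsW),
      (continuous_apply (Fin.last m)).continuousAt.eventually
        (Iio_mem_nhds (lt_add_one (s (Fin.last m))))] with q h1 h2 h3 h4
    exact ⟨h1, h2, h3, h4⟩
  -- A neighbourhood of `s` has positive measure, yet almost all of it lies in the null preimage of
  -- the slice of `N` at the regime `r m`.
  refine (Measure.measure_pos_of_mem_nhds volume hev).ne' (measure_mono_null_ae ?_ hnull)
  filter_upwards [ae_switchPosition_mem_of_resolvent_compl_eq_zero hsmooth hcomplete hN hr h
    (s (Fin.last m) + 1)] with q hq hqs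
  obtain ⟨h1, h2, h3, h4⟩ := hqs
  have h5 := hq (pos_of_mem_flowChainDomain h2) h4
  rw [switchPosition_pathOf_eq_flowChain hflow h2] at h5
  exact ⟨h1, hWt h3, h5⟩

end Resolvent

end Switching

end

theorem theorem3 {n k : ℕ} {M : Type*} [TopologicalSpace M] [T2Space M]
    [SecondCountableTopology M] [ChartedSpace (EuclideanSpace ℝ (Fin n)) M]
    [IsManifold (𝓡 n) ∞ M] [MeasurableSpace M] [BorelSpace M]
    (u : Fin k → (x : M) → TangentSpace (𝓡 n) x)
    (hsmooth : ∀ i, Switching.IsSmoothField (u i))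
    (hcomplete : ∀ i, Switching.ForwardComplete (u i))
    (R : Switching.SwitchingLaw (Fin k))
    (leb : Measure M) (hleb : Switching.IsLebesgueMeasure (n := n) leb)
    (ξ : M) (hB : Switching.ConditionB u ξ) (i : Fin k) :
    Switching.HasNonzeroACComponent (Switching.resolvent u R ξ i)
      (leb.prod (Measure.count : Measure (Fin k))) := by
  have := Switching.isFiniteMeasure_resolvent hsmooth hcomplete R ξ i
  exact Switching.hasNonzeroACComponent_of_not_singular fun N hN h0 =>
    Switching.resolvent_compl_ne_zero_of_null hsmooth hcomplete R hleb hB i hN h0
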